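/- Let $\mu_{sc}$ be the centred semicircular distribution of variance $1$ on $\mathbb{R}$, with density $\frac{1}{2\pi}\sqrt{4-x^2}$ on $[-2,2]$. For a compactly supported probability measure $\mu$ on $\mathbb{R}$ and $t\ge 0$ let $t\mu$ be the distribution of $ta$ when $a$ has distribution $\mu$. Let $\oplus$ denote classical additive convolution (the distribution of a sum of classically independent random variables) and $\boxplus$ free additive convolution (the distribution of a sum of freely independent self-adjoint random variables in a unital $C^*$-algebra with a state). For $q\in[0,1)$ put \[ \mu_q=\sqrt q\left(\tfrac{1}{\sqrt2}\mu_{sc}\oplus\tfrac{1}{\sqrt2}\mu_{sc}\right)\boxplus\sqrt{1-q}\,\mu_{sc}. \] For a partition of $\{1,\dots,n\}$, its intersection graph has the blocks as vertices, two distinct blocks being adjacent if and only if they cross, i.e. one contains $v_1,v_2$ and the other $w_1,w_2$ with $v_1<w_1<v_2<w_2$. Let $\mathcal{P}_2^{\mathrm{bicon}}(n)$ be the set of partitions of $\{1,\dots,n\}$ into blocks of size two whose intersection graph is bipartite and connected. Then all moments $M_n=\int_{\mathbb{R}}x^n\,d\mu_q(x)$, $n\ge 0$, exist; $M_n=0$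 if $n$ is odd; $M_2=1$; and for every even $n\ge 4$, \[ M_n=\sum_{\substack{k_1,k_2\ge 0\\ k_1+k_2=n-2}}M_{k_1}M_{k_2}+\sum_{2\le j\le n/2}\ \sum_{\substack{k_1,\dots,k_{2j}\ge 0\\ k_1+\cdots+k_{2j}=n-2j}}2\left(\frac q2\right)^{j}\left|\mathcal{P}_2^{\mathrm{bicon}}(2j)\right|M_{k_1}\cdots M_{k_{2j}}. \] -/

import Mathlib

open MeasureTheory
open scoped ComplexOrder

/-- The centred semicircular distribution of variance `1`: it has density
`√(4 - x²) / (2π)` on `[-2, 2]` and `0` elsewhere (`Real.sqrt` vanishes at negative numbers). -/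
noncomputable def semicircle : Measure ℝ :=
  volume.withDensity fun x => ENNReal.ofReal (Real.sqrt (4 - x ^ 2) / (2 * Real.pi))

/-- The dilation `t μ` of a measure: the distribution of `t a` if `a` has distribution `μ`. -/
noncomputable def dilation (t : ℝ) (μ : Measure ℝ) : Measure ℝ :=
  μ.map fun x => t * x

/-- A unital positive linear functional (a state). A unital C*-algebra together with a state is a
non-commutative probability space. -/
def IsState {A : Type*} [CStarAlgebra A] (φ : A →ₗ[ℂ] ℂ) : Prop :=
  φ 1 = 1 ∧ ∀ a : A, 0 ≤ φ (star a * a)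

/-- Free independence of a family of unital subalgebras with respect to `φ`: a product of
centred elements, any two neighbouring factors coming from different subalgebras, is centred. -/
def FreelyIndependent {A : Type*} [CStarAlgebra A] {ι : Type*} (φ : A →ₗ[ℂ] ℂ)
    (𝒜 : ι → Subalgebra ℂ A) : Prop :=
  ∀ (n : ℕ) (i : Fin (n + 1) → ι) (x : Fin (n + 1) → A),
    (∀ k : Fin n, i k.castSucc ≠ i k.succ) → (∀ k, x k ∈ 𝒜 (i k)) → (∀ k, φ (x k) = 0) →
      φ (List.ofFn x).prod = 0

/-- The self-adjoint random variable `a` has distribution `μ`: `μ` is the compactly supported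
probability measure on `ℝ` whose moments are the moments of `a`. -/
def HasDistribution {A : Type*} [CStarAlgebra A] (φ : A →ₗ[ℂ] ℂ) (a : A) (μ : Measure ℝ) : Prop :=
  IsSelfAdjoint a ∧ IsProbabilityMeasure μ ∧ (∃ K : Set ℝ, IsCompact K ∧ μ Kᶜ = 0) ∧
    ∀ n : ℕ, φ (a ^ n) = ((∫ x, x ^ n ∂μ : ℝ) : ℂ)

/-- `ρ` is the distribution of `a + b`, where `a` and `b` are freely independent self-adjoint
random variables, in some non-commutative probability space, with distributions `μ` and `ν`. -/
def IsFreeAddConv (μ ν ρ : Measure ℝ) : Prop :=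
  ∃ (A : Type) (_ : CStarAlgebra A) (φ : A →ₗ[ℂ] ℂ) (a b : A),
    IsState φ ∧
    FreelyIndependent φ ![Algebra.adjoin ℂ {a}, Algebra.adjoin ℂ {b}] ∧
    HasDistribution φ a μ ∧ HasDistribution φ b ν ∧ HasDistribution φ (a + b) ρ

open Classical in
/-- The free additive convolution `μ ⊞ ν` of compactly supported probability measures. (For such
`μ` and `ν` there is exactly one `ρ` with `IsFreeAddConv μ ν ρ`; the value `0` is a default that
is used for other `μ`, `ν` only.) -/
noncomputable def freeAddConv (μ ν : Measure ℝ) : Measure ℝ :=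
  if h : ∃ ρ, IsFreeAddConv μ ν ρ then h.choose else 0

/-- The classical convolution of two copies of `(1/√2) μ_sc`. -/
noncomputable def muOne : Measure ℝ :=
  Measure.conv (dilation (1 / Real.sqrt 2) semicircle) (dilation (1 / Real.sqrt 2) semicircle)

/-- `μ_q = √q ((1/√2) μ_sc ⊕ (1/√2) μ_sc) ⊞ √(1 - q) μ_sc`. -/
noncomputable def muQ (q : ℝ) : Measure ℝ :=
  freeAddConv (dilation (Real.sqrt q) muOne) (dilation (Real.sqrt (1 - q)) semicircle)

/-- `V` and `W` contain `v₁, v₂ ∈ V` and `w₁, w₂ ∈ W` with `v₁ < w₁ < v₂ < w₂`. -/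
def Crosses {n : ℕ} (V W : Finset (Fin n)) : Prop :=
  ∃ v₁ ∈ V, ∃ v₂ ∈ V, ∃ w₁ ∈ W, ∃ w₂ ∈ W, v₁ < w₁ ∧ w₁ < v₂ ∧ v₂ < w₂

/-- The intersection graph of a partition: its vertices are the blocks, and two distinct blocks
are adjacent if they cross (in either order). -/
def intersectionGraph {n : ℕ} (π : Finpartition (Finset.univ : Finset (Fin n))) :
    SimpleGraph {V : Finset (Fin n) // V ∈ π.parts} :=
  SimpleGraph.fromRel fun V W => Crosses V.1 W.1

/-- The pair partitions of an `n`-element ordered set whose intersection graph is bipartite and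
connected. -/
def biconPairPartitions (n : ℕ) : Set (Finpartition (Finset.univ : Finset (Fin n))) :=
  {π | (∀ V ∈ π.parts, V.card = 2) ∧ (intersectionGraph π).IsBipartite ∧
    (intersectionGraph π).Connected}

/-! Free cumulants reduce the claim to a count. If a moment series `A` has free cumulants `κ`, then
`A = 1 + ∑ κ_s (X A)^s`. Comparing coefficients, the asserted recursion says that `μ_q` has second
free cumulant `1`, free cumulant `2 (q/2)^j |P₂^bicon(2j)|` in order `2j ≥ 4`, and none in odd
order.

Combinatorics. A semicircular moment counts noncrossing pairings. By the binomial formula, the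
`n`-th moment of a sum of two independent standard semicircular variables counts pairings of `n`
points by arcs of two colours in which equal colours do not cross. Such a diagram consists of the
crossing component of its first point and of arbitrary diagrams in the gaps of that component
(`card_diagrams_eq_sum`, `sum_card_gapDiagrams`). This is the moment-cumulant relation, with the
numbers of connected diagrams as cumulants (`diagramCount_eq_sum`). A connected bipartite graph has
exactly two proper 2-colourings, hence the factor `2` (`linkedCount_univ`). Dilation by `√q / √2`
contributes `(q/2)^j` in order `2j`; in order two the cumulant becomes `q`.

Free convolution. A free semicircular summand of variance `1 - q` raises the second cumulant from
`q` to `1` and leaves the others unchanged. This is shown in a Fock space model with an operator `l`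
such that `l* a^k l = φ(a^k)` and `l* a^k Ω = 0`. There `a` and `l + l*` are free
(`IsCreation.freelyIndependent`), the mixed moments `φ(a^k (a + σ(l + l*))^n)` satisfy a recursion
(`IsCreation.vectorState_pow_recursion`), and generating series solve it
(`coeff_eq_of_semicircular_perturbation`). Since `freeAddConv` is chosen from arbitrary algebras,
two further facts are needed: the model element has a distribution
(`IsState.exists_hasDistribution`), and freeness determines the moments of a sum
(`FreelyIndependent.moments_add_eq`). -/

/-! ### Coloured arc diagrams -/

/-- An arc `(i, j, c)` joins the points `i` and `j` of the line and has the colour `c`. -/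
abbrev Arc := ℕ × ℕ × Bool

/-- `a` is an end of the arc `e`. -/
def Arc.HasEnd (e : Arc) (a : ℕ) : Prop := e.1 = a ∨ e.2.1 = a

/-- The point `a` lies strictly under the arc `e`. -/
def Arc.Spans (e : Arc) (a : ℕ) : Prop := e.1 < a ∧ a < e.2.1

/-- The arcs `e` and `f` cross, in either order. -/
def Arc.Cross (e f : Arc) : Prop :=
  (e.1 < f.1 ∧ f.1 < e.2.1 ∧ e.2.1 < f.2.1) ∨ (f.1 < e.1 ∧ e.1 < f.2.1 ∧ f.2.1 < e.2.1)

theorem Arc.Cross.symm {e f : Arc} (h : e.Cross f) : f.Cross e := Or.symm h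

/-- `Q` is a perfect matching of `A` by arcs with colours in `Λ`, such that arcs of the same
colour do not cross. -/
structure IsDiagram (Λ : Finset Bool) (A : Finset ℕ) (Q : Finset Arc) : Prop where
  lt : ∀ e ∈ Q, e.1 < e.2.1
  fst_mem : ∀ e ∈ Q, e.1 ∈ A
  snd_mem : ∀ e ∈ Q, e.2.1 ∈ A
  colour_mem : ∀ e ∈ Q, e.2.2 ∈ Λ
  cover : ∀ a ∈ A, ∃ e ∈ Q, e.HasEnd a
  inj : ∀ e ∈ Q, ∀ f ∈ Q, ∀ a, e.HasEnd a → f.HasEnd a → e = f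
  not_cross : ∀ e ∈ Q, ∀ f ∈ Q, e.2.2 = f.2.2 → ¬ e.Cross f

/-- The arcs `e` and `f` are linked by a chain of crossing arcs of `Q`. -/
def Linked (Q : Finset Arc) : Arc → Arc → Prop :=
  Relation.ReflTransGen fun e f => f ∈ Q ∧ e.Cross f

/-- Any two arcs of `Q` are linked. -/
def IsLinked (Q : Finset Arc) : Prop := ∀ e ∈ Q, ∀ f ∈ Q, Linked Q e f

open Classical in
/-- The diagrams on `A`. -/
noncomputable def diagrams (Λ : Finset Bool) (A : Finset ℕ) : Finset (Finset Arc) :=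
  (A ×ˢ A ×ˢ Λ).powerset.filter (IsDiagram Λ A)

open Classical in
/-- The connected diagrams on `A`. -/
noncomputable def linkedDiagrams (Λ : Finset Bool) (A : Finset ℕ) : Finset (Finset Arc) :=
  (diagrams Λ A).filter IsLinked

open Classical in
/-- The diagrams on `A \ V` whose arcs do not span any point of `V`. -/
noncomputable def gapDiagrams (Λ : Finset Bool) (A V : Finset ℕ) : Finset (Finset Arc) :=
  (diagrams Λ (A \ V)).filter fun Q => ∀ e ∈ Q, ∀ v ∈ V, ¬ e.Spans v

/-- The set of ends of the arcs of `Q`. -/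
def support (Q : Finset Arc) : Finset ℕ := Q.image (fun e => e.1) ∪ Q.image (fun e => e.2.1)

open Classical in
/-- The connected component of the arc at the point `0`. -/
noncomputable def zeroComponent (Q : Finset Arc) : Finset Arc :=
  Q.filter fun f => ∃ e ∈ Q, e.1 = 0 ∧ Linked Q e f

/-! ### Diagrams: ends, restriction and union. -/

section

variable {Λ : Finset Bool} {A B V : Finset ℕ} {P Q R C : Finset Arc}

theorem mem_diagrams : Q ∈ diagrams Λ A ↔ IsDiagram Λ A Q := by
  simp only [diagrams, Finset.mem_filter, Finset.mem_powerset, and_iff_right_iff_imp]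
  intro h e he
  simp [h.fst_mem e he, h.snd_mem e he, h.colour_mem e he]

theorem mem_linkedDiagrams : Q ∈ linkedDiagrams Λ A ↔ IsDiagram Λ A Q ∧ IsLinked Q := by
  simp [linkedDiagrams, mem_diagrams]

theorem mem_gapDiagrams :
    Q ∈ gapDiagrams Λ A V ↔ IsDiagram Λ (A \ V) Q ∧ ∀ e ∈ Q, ∀ v ∈ V, ¬ e.Spans v := by
  simp [gapDiagrams, mem_diagrams]

theorem mem_support {a : ℕ} : a ∈ support Q ↔ ∃ e ∈ Q, e.HasEnd a := by
  simp only [support, Finset.mem_union, Finset.mem_image, Arc.HasEnd]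
  constructor
  · rintro (⟨e, he, h⟩ | ⟨e, he, h⟩)
    exacts [⟨e, he, .inl h⟩, ⟨e, he, .inr h⟩]
  · rintro ⟨e, he, h | h⟩
    exacts [.inl ⟨e, he, h⟩, .inr ⟨e, he, h⟩]

theorem IsDiagram.hasEnd_mem (h : IsDiagram Λ A Q) {e : Arc} (he : e ∈ Q) {a : ℕ}
    (ha : e.HasEnd a) : a ∈ A := by
  rcases ha with rfl | rfl
  exacts [h.fst_mem e he, h.snd_mem e he]

theorem IsDiagram.support_eq (h : IsDiagram Λ A Q) : support Q = A := by
  ext a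
  rw [mem_support]
  exact ⟨fun ⟨e, he, ha⟩ => h.hasEnd_mem he ha, h.cover a⟩

theorem IsDiagram.ends_ne (h : IsDiagram Λ A Q) {e f : Arc} (he : e ∈ Q) (hf : f ∈ Q)
    (hne : e ≠ f) : e.1 ≠ f.1 ∧ e.1 ≠ f.2.1 ∧ e.2.1 ≠ f.1 ∧ e.2.1 ≠ f.2.1 := by
  refine ⟨fun h' => hne ?_, fun h' => hne ?_, fun h' => hne ?_, fun h' => hne ?_⟩
  · exact h.inj e he f hf _ (.inl rfl) (.inl h'.symm)
  · exact h.inj e he f hf _ (.inl rfl) (.inr h'.symm)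
  · exact h.inj e he f hf _ (.inr rfl) (.inl h'.symm)
  · exact h.inj e he f hf _ (.inr rfl) (.inr h'.symm)

theorem isDiagram_empty : IsDiagram Λ ∅ ∅ := by
  constructor <;> simp

theorem IsDiagram.eq_empty (h : IsDiagram Λ ∅ Q) : Q = ∅ := by
  refine Finset.eq_empty_of_forall_notMem fun e he => ?_
  simpa using h.fst_mem e he

theorem diagrams_empty : diagrams Λ ∅ = {∅} := by
  ext Q
  rw [mem_diagrams, Finset.mem_singleton]
  exact ⟨fun h => h.eq_empty, fun h => h ▸ isDiagram_empty⟩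

/-- A set of arcs of a diagram is a diagram on a smaller set of points, if no other arc has an
end in that set. -/
theorem IsDiagram.restrict (h : IsDiagram Λ A Q) (hC : C ⊆ Q) (hB : B ⊆ A)
    (hin : ∀ e ∈ C, e.1 ∈ B ∧ e.2.1 ∈ B) (hout : ∀ e ∈ Q, e ∉ C → e.1 ∉ B ∧ e.2.1 ∉ B) :
    IsDiagram Λ B C where
  lt e he := h.lt e (hC he)
  fst_mem e he := (hin e he).1
  snd_mem e he := (hin e he).2
  colour_mem e he := h.colour_mem e (hC he)
  cover a ha := by
    obtain ⟨e, he, hea⟩ := h.cover a (hB ha)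
    refine ⟨e, ?_, hea⟩
    by_contra hn
    have := hout e he hn
    rcases hea with rfl | rfl
    exacts [this.1 ha, this.2 ha]
  inj e he f hf := h.inj e (hC he) f (hC hf)
  not_cross e he f hf := h.not_cross e (hC he) f (hC hf)

theorem IsDiagram.restrict_colours {Λ' : Finset Bool} (h : IsDiagram Λ A Q)
    (hΛ : ∀ e ∈ Q, e.2.2 ∈ Λ') : IsDiagram Λ' A Q :=
  ⟨h.lt, h.fst_mem, h.snd_mem, hΛ, h.cover, h.inj, h.not_cross⟩

theorem IsDiagram.union (hP : IsDiagram Λ A P) (hR : IsDiagram Λ B R) (hAB : Disjoint A B)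
    (hc : ∀ e ∈ P, ∀ f ∈ R, e.2.2 = f.2.2 → ¬ e.Cross f) : IsDiagram Λ (A ∪ B) (P ∪ R) := by
  have hd : ∀ e ∈ P, ∀ f ∈ R, ∀ a, e.HasEnd a → ¬ f.HasEnd a := fun e he f hf a h1 h2 =>
    Finset.disjoint_left.1 hAB (hP.hasEnd_mem he h1) (hR.hasEnd_mem hf h2)
  constructor
  · intro e he
    rcases Finset.mem_union.1 he with he | he
    exacts [hP.lt e he, hR.lt e he]
  · intro e he
    rcases Finset.mem_union.1 he with he | he
    exacts [Finset.mem_union_left _ (hP.fst_mem e he), Finset.mem_union_right _ (hR.fst_mem e he)]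
  · intro e he
    rcases Finset.mem_union.1 he with he | he
    exacts [Finset.mem_union_left _ (hP.snd_mem e he), Finset.mem_union_right _ (hR.snd_mem e he)]
  · intro e he
    rcases Finset.mem_union.1 he with he | he
    exacts [hP.colour_mem e he, hR.colour_mem e he]
  · intro a ha
    rcases Finset.mem_union.1 ha with ha | ha
    · obtain ⟨e, he, hea⟩ := hP.cover a ha
      exact ⟨e, Finset.mem_union_left _ he, hea⟩
    · obtain ⟨e, he, hea⟩ := hR.cover a ha
      exact ⟨e, Finset.mem_union_right _ he, hea⟩
  · intro e he f hf a hea hfa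
    rcases Finset.mem_union.1 he with he | he <;> rcases Finset.mem_union.1 hf with hf | hf
    · exact hP.inj e he f hf a hea hfa
    · exact absurd hfa (hd e he f hf a hea)
    · exact absurd hea (hd f hf e he a hfa)
    · exact hR.inj e he f hf a hea hfa
  · intro e he f hf hef
    rcases Finset.mem_union.1 he with he | he <;> rcases Finset.mem_union.1 hf with hf | hf
    · exact hP.not_cross e he f hf hef
    · exact hc e he f hf hef
    · exact fun h => hc f hf e he hef.symm h.symm
    · exact hR.not_cross e he f hf hef

theorem IsDiagram.disjoint (hP : IsDiagram Λ A P) (hR : IsDiagram Λ B R) (hAB : Disjoint A B) :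
    Disjoint P R :=
  Finset.disjoint_left.2 fun e he he' =>
    Finset.disjoint_left.1 hAB (hP.fst_mem e he) (hR.fst_mem e he')

/-! ### The component of the first arc -/

theorem Linked.mono (hPQ : P ⊆ Q) {e f : Arc} (h : Linked P e f) : Linked Q e f := by
  induction h with
  | refl => exact .refl
  | tail _ h ih => exact ih.tail ⟨hPQ h.1, h.2⟩

theorem Linked.symm {e f : Arc} (he : e ∈ Q) (h : Linked Q e f) : f ∈ Q ∧ Linked Q f e := by
  induction h with
  | refl => exact ⟨he, .refl⟩
  | tail _ hst ih => exact ⟨hst.1, Relation.ReflTransGen.head ⟨ih.1, hst.2.symm⟩ ih.2⟩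

theorem zeroComponent_subset : zeroComponent Q ⊆ Q := by
  classical exact Finset.filter_subset _ _

theorem mem_zeroComponent {f : Arc} :
    f ∈ zeroComponent Q ↔ f ∈ Q ∧ ∃ e ∈ Q, e.1 = 0 ∧ Linked Q e f := by
  simp [zeroComponent]

theorem mem_zeroComponent_of_cross {e f : Arc} (he : e ∈ zeroComponent Q) (hf : f ∈ Q)
    (h : e.Cross f) : f ∈ zeroComponent Q := by
  obtain ⟨_, x, hx, hx0, hxe⟩ := mem_zeroComponent.1 he
  exact mem_zeroComponent.2 ⟨hf, x, hx, hx0, hxe.tail ⟨hf, h⟩⟩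

theorem linked_zeroComponent {e f : Arc} (he : e ∈ Q) (he0 : e.1 = 0) (h : Linked Q e f) :
    f ∈ zeroComponent Q ∧ Linked (zeroComponent Q) e f := by
  induction h with
  | refl => exact ⟨mem_zeroComponent.2 ⟨he, e, he, he0, .refl⟩, .refl⟩
  | tail _ hst ih =>
    have := mem_zeroComponent_of_cross ih.1 hst.1 hst.2
    exact ⟨this, ih.2.tail ⟨this, hst.2⟩⟩

theorem IsDiagram.isLinked_zeroComponent (h : IsDiagram Λ A Q) : IsLinked (zeroComponent Q) := by
  intro e he f hf
  obtain ⟨-, x, hx, hx0, hxe⟩ := mem_zeroComponent.1 he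
  obtain ⟨-, y, hy, hy0, hyf⟩ := mem_zeroComponent.1 hf
  obtain rfl : x = y := h.inj x hx y hy 0 (.inl hx0) (.inl hy0)
  have hx' : x ∈ zeroComponent Q := mem_zeroComponent.2 ⟨hx, x, hx, hx0, .refl⟩
  exact ((linked_zeroComponent hx hx0 hxe).2.symm hx').2.trans (linked_zeroComponent hx hx0 hyf).2

theorem IsDiagram.restrict_support (h : IsDiagram Λ A Q) (hC : C ⊆ Q) :
    IsDiagram Λ (support C) C := by
  refine h.restrict hC ?_ (fun e he => ⟨mem_support.2 ⟨e, he, .inl rfl⟩,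
    mem_support.2 ⟨e, he, .inr rfl⟩⟩) fun e he hn => ⟨fun hm => hn ?_, fun hm => hn ?_⟩
  · intro a ha
    obtain ⟨e, he, hea⟩ := mem_support.1 ha
    exact h.hasEnd_mem (hC he) hea
  · obtain ⟨f, hf, hfa⟩ := mem_support.1 hm
    rwa [h.inj e he f (hC hf) _ (.inl rfl) hfa]
  · obtain ⟨f, hf, hfa⟩ := mem_support.1 hm
    rwa [h.inj e he f (hC hf) _ (.inr rfl) hfa]

theorem IsDiagram.sdiff (h : IsDiagram Λ A Q) (hC : C ⊆ Q) :
    IsDiagram Λ (A \ support C) (Q \ C) := by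
  refine h.restrict Finset.sdiff_subset Finset.sdiff_subset (fun e he => ?_) fun e he hn => ?_
  · rw [Finset.mem_sdiff] at he
    constructor
    · refine Finset.mem_sdiff.2 ⟨h.fst_mem e he.1, fun hm => he.2 ?_⟩
      obtain ⟨f, hf, hfa⟩ := mem_support.1 hm
      rwa [h.inj e he.1 f (hC hf) _ (.inl rfl) hfa]
    · refine Finset.mem_sdiff.2 ⟨h.snd_mem e he.1, fun hm => he.2 ?_⟩
      obtain ⟨f, hf, hfa⟩ := mem_support.1 hm
      rwa [h.inj e he.1 f (hC hf) _ (.inr rfl) hfa]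
  · have heC : e ∈ C := by
      by_contra h'
      exact hn (Finset.mem_sdiff.2 ⟨he, h'⟩)
    simp only [Finset.mem_sdiff, not_and, not_not]
    exact ⟨fun _ => mem_support.2 ⟨e, heC, .inl rfl⟩, fun _ => mem_support.2 ⟨e, heC, .inr rfl⟩⟩

/-- Induction along a chain of crossings from the arc at `0`, whose left end nothing can span. An
arc outside the component crosses no `g` in it, so if it spans one end of `g` it spans both; then it
spans the end of the preceding arc that lies under `g`. -/
theorem IsDiagram.not_spans_zeroComponent (h : IsDiagram Λ A Q) :
    ∀ e ∈ Q \ zeroComponent Q, ∀ v ∈ support (zeroComponent Q), ¬ e.Spans v := by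
  intro e he
  rw [Finset.mem_sdiff] at he
  have key : ∀ f ∈ zeroComponent Q, ¬ e.Spans f.1 ∧ ¬ e.Spans f.2.1 := by
    intro f hf
    obtain ⟨-, x, hx, hx0, hxf⟩ := mem_zeroComponent.1 hf
    have hxC : x ∈ zeroComponent Q := mem_zeroComponent.2 ⟨hx, x, hx, hx0, .refl⟩
    have hxe := h.ends_ne hx he.1 (fun hxe => he.2 (hxe ▸ hxC))
    clear hf
    induction hxf with
    | refl =>
      have hc : ¬ x.Cross e := fun hc => he.2 (mem_zeroComponent_of_cross hxC he.1 hc)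
      have := h.lt x hx
      simp only [Arc.Spans, Arc.Cross] at *
      omega
    | @tail f g hxf hfg ih =>
      have hg := (linked_zeroComponent hx hx0 (hxf.tail hfg)).1
      have hge := h.ends_ne hfg.1 he.1 (fun hge => he.2 (hge ▸ hg))
      have hc : ¬ g.Cross e := fun hc => he.2 (mem_zeroComponent_of_cross hg he.1 hc)
      have := h.lt g hfg.1
      have := hfg.2
      simp only [Arc.Spans, Arc.Cross] at *
      omega
  intro v hv
  obtain ⟨f, hf, rfl | rfl⟩ := mem_support.1 hv
  exacts [(key f hf).1, (key f hf).2]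

/-- Of two crossing arcs, each spans an end of the other. -/
theorem not_cross_of_gap (hC : IsDiagram Λ V C) (hR : ∀ e ∈ R, ∀ v ∈ V, ¬ e.Spans v) :
    ∀ e ∈ C, ∀ f ∈ R, ¬ e.Cross f := by
  intro e he f hf
  have h1 := hR f hf _ (hC.fst_mem e he)
  have h2 := hR f hf _ (hC.snd_mem e he)
  simp only [Arc.Spans, Arc.Cross] at *
  omega

/-- A chain of crossings that starts in `C` cannot leave it, because the arcs in the gaps cross no
arc of `C`. This makes the decomposition of a diagram invertible. -/
theorem zeroComponent_union (hC : IsDiagram Λ V C) (hl : IsLinked C) (h0 : 0 ∈ V)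
    (hRd : IsDiagram Λ (A \ V) R) (hR : ∀ e ∈ R, ∀ v ∈ V, ¬ e.Spans v) :
    zeroComponent (C ∪ R) = C := by
  have hx : ∀ x ∈ C ∪ R, x.1 = 0 → x ∈ C := by
    intro x hx hx0
    refine (Finset.mem_union.1 hx).resolve_right fun hxR => ?_
    have := hRd.fst_mem x hxR
    rw [hx0, Finset.mem_sdiff] at this
    exact this.2 h0
  ext f
  rw [mem_zeroComponent]
  constructor
  · rintro ⟨-, x, hxm, hx0, hxf⟩
    induction hxf with
    | refl => exact hx x hxm hx0
    | tail _ hst ih =>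
      exact (Finset.mem_union.1 hst.1).resolve_right fun hR' =>
        not_cross_of_gap hC hR _ ih _ hR' hst.2
  · intro hf
    obtain ⟨x, hxC, hx0⟩ := hC.cover 0 h0
    have hx0 : x.1 = 0 := by
      have := hC.lt x hxC
      rcases hx0 with h | h
      · exact h
      · omega
    exact ⟨Finset.mem_union_left _ hf, x, Finset.mem_union_left _ hxC, hx0,
      (hl x hxC f hf).mono Finset.subset_union_left⟩

/-- A diagram is determined by the component of the point `0` and the remaining arcs, which lie
in the gaps of that component. -/
theorem card_diagrams_eq_sum (h0 : 0 ∈ A) :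
    (diagrams Λ A).card = ∑ V ∈ A.powerset.filter (0 ∈ ·),
      (linkedDiagrams Λ V).card * (gapDiagrams Λ A V).card := by
  simp_rw [← Finset.card_product]
  rw [← Finset.card_sigma]
  refine Finset.card_nbij'
    (fun Q => ⟨support (zeroComponent Q), zeroComponent Q, Q \ zeroComponent Q⟩)
    (fun x => x.2.1 ∪ x.2.2) ?_ ?_ ?_ ?_
  · intro Q hQ
    have h := mem_diagrams.1 hQ
    have hs := h.restrict_support (zeroComponent_subset (Q := Q))
    simp only [Finset.coe_sigma, Set.mem_sigma_iff, Finset.mem_coe, Finset.mem_filter,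
      Finset.mem_powerset, Finset.mem_product, mem_linkedDiagrams, mem_gapDiagrams]
    refine ⟨⟨?_, ?_⟩, ⟨hs, h.isLinked_zeroComponent⟩, h.sdiff zeroComponent_subset,
      h.not_spans_zeroComponent⟩
    · intro a ha
      obtain ⟨e, he, hea⟩ := mem_support.1 ha
      exact h.hasEnd_mem (zeroComponent_subset he) hea
    · obtain ⟨x, hxQ, hx0⟩ := h.cover 0 h0
      have hx0 : x.1 = 0 := by
        have := h.lt x hxQ
        rcases hx0 with h | h
        · exact h
        · omega
      exact mem_support.2 ⟨x, mem_zeroComponent.2 ⟨hxQ, x, hxQ, hx0, .refl⟩, .inl hx0⟩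
  · rintro ⟨V, C, R⟩ hx
    simp only [Finset.coe_sigma, Set.mem_sigma_iff, Finset.mem_coe, Finset.mem_filter,
      Finset.mem_powerset, Finset.mem_product, mem_linkedDiagrams, mem_gapDiagrams] at hx
    obtain ⟨⟨hV, h0V⟩, ⟨hC, hl⟩, hRd, hR⟩ := hx
    have := hC.union hRd Finset.disjoint_sdiff
      fun e he f hf _ => not_cross_of_gap hC hR e he f hf
    rw [Finset.union_sdiff_of_subset hV] at this
    exact mem_diagrams.2 this
  · intro Q _
    exact Finset.union_sdiff_of_subset zeroComponent_subset
  · rintro ⟨V, C, R⟩ hx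
    simp only [Finset.coe_sigma, Set.mem_sigma_iff, Finset.mem_coe, Finset.mem_filter,
      Finset.mem_powerset, Finset.mem_product, mem_linkedDiagrams, mem_gapDiagrams] at hx
    obtain ⟨⟨hV, h0V⟩, ⟨hC, hl⟩, hRd, hR⟩ := hx
    have h1 := zeroComponent_union hC hl h0V hRd hR
    have h2 : (C ∪ R) \ C = R := by
      rw [Finset.union_sdiff_cancel_left (hC.disjoint hRd Finset.disjoint_sdiff)]
    simp [h1, h2, hC.support_eq]

/-! ### The gaps of a component -/

/-- As `v` lies above all of `V`, an arc that does not span `v` lies on one side of it. The arcs on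
the right fill the last gap and are subject to no further condition. -/
theorem card_gapDiagrams_insert {n v : ℕ} (hv : v < n) (hV : V ⊆ Finset.range v) :
    (gapDiagrams Λ (Finset.range n) (insert v V)).card =
      (gapDiagrams Λ (Finset.range v) V).card * (diagrams Λ (Finset.Ico (v + 1) n)).card := by
  have hV' : ∀ w ∈ V, w < v := fun w hw => Finset.mem_range.1 (hV hw)
  have hunion : Finset.range n \ insert v V =
      (Finset.range v \ V) ∪ Finset.Ico (v + 1) n := by
    ext a
    simp only [Finset.mem_sdiff, Finset.mem_range, Finset.mem_insert, Finset.mem_union,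
      Finset.mem_Ico]
    by_cases ha : a ∈ V
    · have := hV' a ha
      simp only [ha, or_true, not_true_eq_false, and_false, false_or, false_iff]
      omega
    · simp only [ha, or_false, not_false_eq_true, and_true]
      omega
  rw [← Finset.card_product]
  refine Finset.card_nbij' (fun Q => (Q.filter fun e => e.2.1 < v, Q.filter fun e => v < e.1))
    (fun x => x.1 ∪ x.2) ?_ ?_ ?_ ?_
  · intro Q hQ
    simp only [Finset.mem_coe, mem_gapDiagrams, Finset.mem_product, mem_diagrams] at hQ ⊢
    obtain ⟨hQ, hs⟩ := hQ
    have hside : ∀ e ∈ Q, e.2.1 < v ∨ v < e.1 := by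
      intro e he
      have h1 := hs e he v (Finset.mem_insert_self _ _)
      have h2 := hQ.fst_mem e he
      have h3 := hQ.snd_mem e he
      simp only [Finset.mem_sdiff, Finset.mem_insert, not_or, Arc.Spans] at *
      omega
    refine ⟨⟨?_, ?_⟩, ?_⟩
    · refine hQ.restrict (Finset.filter_subset _ _) (hunion ▸ Finset.subset_union_left) ?_ ?_
      · intro e he
        rw [Finset.mem_filter] at he
        have h2 := hQ.fst_mem e he.1
        have h3 := hQ.snd_mem e he.1
        have h4 := hQ.lt e he.1
        simp only [Finset.mem_sdiff, Finset.mem_insert, not_or, Finset.mem_range] at *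
        exact ⟨⟨by omega, h2.2.2⟩, ⟨by omega, h3.2.2⟩⟩
      · intro e he hn
        have h4 := hQ.lt e he
        have h5 := hside e he
        simp only [Finset.mem_filter, he, true_and] at hn
        simp only [Finset.mem_sdiff, Finset.mem_range]
        constructor <;> omega
    · intro e he w hw
      exact hs e (Finset.mem_of_mem_filter e he) w (Finset.mem_insert_of_mem hw)
    · refine hQ.restrict (Finset.filter_subset _ _) (hunion ▸ Finset.subset_union_right) ?_ ?_
      · intro e he
        rw [Finset.mem_filter] at he
        have h2 := hQ.fst_mem e he.1
        have h3 := hQ.snd_mem e he.1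
        have h4 := hQ.lt e he.1
        simp only [Finset.mem_sdiff, Finset.mem_Ico, Finset.mem_range] at *
        omega
      · intro e he hn
        have h4 := hQ.lt e he
        have h5 := hside e he
        simp only [Finset.mem_filter, he, true_and] at hn
        simp only [Finset.mem_Ico]
        constructor <;> omega
  · rintro ⟨P, R⟩ hx
    simp only [Finset.mem_coe, mem_gapDiagrams, Finset.mem_product, mem_diagrams] at hx ⊢
    obtain ⟨⟨hP, hs⟩, hR⟩ := hx
    have hPv : ∀ e ∈ P, e.2.1 < v := fun e he => by
      have := hP.snd_mem e he
      simp only [Finset.mem_sdiff, Finset.mem_range] at this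
      exact this.1
    have hRv : ∀ e ∈ R, v < e.1 := fun e he => by
      have := hR.fst_mem e he
      simp only [Finset.mem_Ico] at this
      omega
    constructor
    · rw [hunion]
      refine hP.union hR ?_ ?_
      · rw [Finset.disjoint_left]
        intro a ha
        simp only [Finset.mem_sdiff, Finset.mem_Ico, Finset.mem_range] at *
        omega
      · intro e he f hf _
        have h1 := hPv e he
        have h2 := hRv f hf
        have h3 := hR.lt f hf
        simp only [Arc.Cross]
        omega
    · intro e he w hw
      rcases Finset.mem_union.1 he with he | he
      · rcases Finset.mem_insert.1 hw with rfl | hw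
        · have := hPv e he
          simp only [Arc.Spans]
          omega
        · exact hs e he w hw
      · have h1 := hRv e he
        have : w ≤ v := by
          rcases Finset.mem_insert.1 hw with rfl | hw
          exacts [le_rfl, (hV' w hw).le]
        simp only [Arc.Spans]
        omega
  · intro Q hQ
    simp only [Finset.mem_coe, mem_gapDiagrams] at hQ
    obtain ⟨hQ, hs⟩ := hQ
    ext e
    simp only [Finset.mem_union, Finset.mem_filter, ← and_or_left, and_iff_left_iff_imp]
    intro he
    have h1 := hs e he v (Finset.mem_insert_self _ _)
    have h2 := hQ.fst_mem e he
    have h3 := hQ.snd_mem e he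
    simp only [Finset.mem_sdiff, Finset.mem_insert, not_or, Arc.Spans] at *
    omega
  · rintro ⟨P, R⟩ hx
    simp only [Finset.mem_coe, mem_gapDiagrams, Finset.mem_product, mem_diagrams] at hx
    obtain ⟨⟨hP, hs⟩, hR⟩ := hx
    have hPv : ∀ e ∈ P, e.1 < v ∧ e.2.1 < v := fun e he => by
      have := hP.snd_mem e he
      have := hP.fst_mem e he
      simp only [Finset.mem_sdiff, Finset.mem_range] at *
      omega
    have hRv : ∀ e ∈ R, v < e.1 ∧ v < e.2.1 := fun e he => by
      have := hR.fst_mem e he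
      have := hR.snd_mem e he
      simp only [Finset.mem_Ico] at *
      omega
    ext e
    · simp only [Finset.mem_filter, Finset.mem_union]
      exact ⟨fun h => h.1.resolve_right fun h' => (h.2.trans (hRv e h').2).false,
        fun h => ⟨.inl h, (hPv e h).2⟩⟩
    · simp only [Finset.mem_filter, Finset.mem_union]
      exact ⟨fun h => h.1.resolve_left fun h' => (h.2.trans (hPv e h').1).false,
        fun h => ⟨.inr h, (hRv e h).1⟩⟩

end

/-! ### Relabelling the points -/

/-- The relabelling of an arc along a strictly increasing map. -/
def arcMap (g : ℕ ↪o ℕ) : Arc ↪ Arc where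
  toFun e := (g e.1, g e.2.1, e.2.2)
  inj' e f h := by
    simp only [Prod.mk.injEq, EmbeddingLike.apply_eq_iff_eq] at h
    exact Prod.ext h.1 (Prod.ext h.2.1 h.2.2)

section

variable {Λ : Finset Bool} {A : Finset ℕ} {Q : Finset Arc} (g : ℕ ↪o ℕ)

@[simp] theorem arcMap_fst (e : Arc) : (arcMap g e).1 = g e.1 := rfl

@[simp] theorem arcMap_snd (e : Arc) : (arcMap g e).2.1 = g e.2.1 := rfl

@[simp] theorem arcMap_colour (e : Arc) : (arcMap g e).2.2 = e.2.2 := rfl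

@[simp] theorem hasEnd_arcMap {e : Arc} {a : ℕ} : (arcMap g e).HasEnd (g a) ↔ e.HasEnd a := by
  simp [Arc.HasEnd]

@[simp] theorem cross_arcMap {e f : Arc} : (arcMap g e).Cross (arcMap g f) ↔ e.Cross f := by
  simp [Arc.Cross]

theorem mem_map_orderEmbedding {a : ℕ} : g a ∈ A.map g.toEmbedding ↔ a ∈ A :=
  Finset.mem_map' g.toEmbedding

theorem isDiagram_map : IsDiagram Λ (A.map g.toEmbedding) (Q.map (arcMap g)) ↔
    IsDiagram Λ A Q := by
  constructor
  · rintro ⟨h1, h2, h3, h4, h5, h6, h7⟩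
    simp only [Finset.forall_mem_map, arcMap_fst, arcMap_snd, arcMap_colour, cross_arcMap,
      OrderEmbedding.lt_iff_lt, mem_map_orderEmbedding] at h1 h2 h3 h4 h7
    refine ⟨h1, h2, h3, h4, fun a ha => ?_, fun e he f hf a hea hfa => ?_, h7⟩
    · obtain ⟨x, hx, hxa⟩ := h5 (g a) ((mem_map_orderEmbedding g).2 ha)
      obtain ⟨e, he, rfl⟩ := Finset.mem_map.1 hx
      exact ⟨e, he, (hasEnd_arcMap g).1 hxa⟩
    · exact (arcMap g).injective (h6 _ (Finset.mem_map_of_mem _ he) _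
        (Finset.mem_map_of_mem _ hf) (g a) ((hasEnd_arcMap g).2 hea) ((hasEnd_arcMap g).2 hfa))
  · rintro ⟨h1, h2, h3, h4, h5, h6, h7⟩
    constructor <;> simp only [Finset.forall_mem_map, arcMap_fst, arcMap_snd, arcMap_colour,
      cross_arcMap, OrderEmbedding.lt_iff_lt, mem_map_orderEmbedding]
    · exact h1
    · exact h2
    · exact h3
    · exact h4
    · intro a ha
      obtain ⟨e, he, hea⟩ := h5 a ha
      exact ⟨_, Finset.mem_map_of_mem _ he, (hasEnd_arcMap g).2 hea⟩
    · rintro e he f hf a hea hfa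
      obtain ⟨b, rfl⟩ : ∃ b, g b = a := by
        rcases hea with h | h
        exacts [⟨e.1, h⟩, ⟨e.2.1, h⟩]
      rw [h6 e he f hf b ((hasEnd_arcMap g).1 hea) ((hasEnd_arcMap g).1 hfa)]
    · exact h7

theorem isLinked_map : IsLinked (Q.map (arcMap g)) ↔ IsLinked Q := by
  have h1 : ∀ e f, Linked Q e f → Linked (Q.map (arcMap g)) (arcMap g e) (arcMap g f) := by
    intro e f h
    induction h with
    | refl => exact .refl
    | tail _ h ih => exact ih.tail ⟨Finset.mem_map_of_mem _ h.1, (cross_arcMap g).2 h.2⟩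
  have h2 : ∀ e x, Linked (Q.map (arcMap g)) (arcMap g e) x → ∃ f, x = arcMap g f ∧
      Linked Q e f := by
    intro e x h
    induction h with
    | refl => exact ⟨e, rfl, .refl⟩
    | tail _ h ih =>
      obtain ⟨f, rfl, hf⟩ := ih
      obtain ⟨y, hy, rfl⟩ := Finset.mem_map.1 h.1
      exact ⟨y, rfl, hf.tail ⟨hy, (cross_arcMap g).1 h.2⟩⟩
  simp only [IsLinked, Finset.forall_mem_map]
  refine forall₄_congr fun e he f hf => ⟨fun h => ?_, h1 e f⟩
  obtain ⟨f', hf', h⟩ := h2 _ _ h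
  rwa [(arcMap g).injective hf']

theorem IsDiagram.exists_map {Q : Finset Arc} (h : IsDiagram Λ (A.map g.toEmbedding) Q) :
    ∃ P : Finset Arc, Q = P.map (arcMap g) := by
  have : Q ⊆ (A ×ˢ A ×ˢ Λ).map (arcMap g) := by
    intro e he
    obtain ⟨a, ha, hae⟩ := Finset.mem_map.1 (h.fst_mem e he)
    obtain ⟨b, hb, hbe⟩ := Finset.mem_map.1 (h.snd_mem e he)
    refine Finset.mem_map.2 ⟨(a, b, e.2.2), ?_, Prod.ext hae (Prod.ext hbe rfl)⟩
    simp [ha, hb, h.colour_mem e he]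
  obtain ⟨P, -, hP⟩ := Finset.subset_map_iff.1 this
  exact ⟨P, hP⟩

theorem diagrams_map : diagrams Λ (A.map g.toEmbedding) =
    (diagrams Λ A).map ⟨_, Finset.map_injective (arcMap g)⟩ := by
  ext Q
  simp only [mem_diagrams, Finset.mem_map, Function.Embedding.coeFn_mk]
  constructor
  · intro h
    obtain ⟨P, rfl⟩ := h.exists_map
    exact ⟨P, (isDiagram_map g).1 h, rfl⟩
  · rintro ⟨P, hP, rfl⟩
    exact (isDiagram_map g).2 hP

theorem linkedDiagrams_map : linkedDiagrams Λ (A.map g.toEmbedding) =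
    (linkedDiagrams Λ A).map ⟨_, Finset.map_injective (arcMap g)⟩ := by
  ext Q
  simp only [mem_linkedDiagrams, Finset.mem_map, Function.Embedding.coeFn_mk]
  constructor
  · rintro ⟨h, hl⟩
    obtain ⟨P, rfl⟩ := h.exists_map
    exact ⟨P, ⟨(isDiagram_map g).1 h, (isLinked_map g).1 hl⟩, rfl⟩
  · rintro ⟨P, ⟨hP, hl⟩, rfl⟩
    exact ⟨(isDiagram_map g).2 hP, (isLinked_map g).2 hl⟩

end

/-- This reduces counting on `A` to counting on an initial segment. Since the embedding must be
defined on all of `ℕ`, the increasing enumeration of `A` is continued past `A.card` by a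
translation. -/
theorem exists_map_range_eq (A : Finset ℕ) :
    ∃ g : ℕ ↪o ℕ, (Finset.range A.card).map g.toEmbedding = A := by
  induction A using Finset.induction_on_max with
  | empty => exact ⟨RelEmbedding.refl _, by simp⟩
  | insert m A hm ih =>
    obtain ⟨g, hg⟩ := ih
    have hlt : ∀ k < A.card, g k < m := fun k hk => hm _ (by
      rw [← hg]; exact Finset.mem_map_of_mem _ (Finset.mem_range.2 hk))
    have hmono : StrictMono fun k => if k < A.card then g k else m + (k - A.card) := by
      intro k l hkl
      simp only
      split_ifs with h1 h2 h2
      · exact g.lt_iff_lt.2 hkl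
      · have := hlt k h1
        omega
      · omega
      · omega
    have hmA : m ∉ A := fun h => (hm m h).false
    refine ⟨OrderEmbedding.ofStrictMono _ hmono, ?_⟩
    rw [Finset.card_insert_of_notMem hmA, Finset.range_add_one, Finset.map_insert]
    congr 1
    · simp
    · refine Eq.trans ?_ hg
      ext a
      simp only [Finset.mem_map, Finset.mem_range, RelEmbedding.coe_toEmbedding,
        OrderEmbedding.coe_ofStrictMono]
      refine exists_congr fun k => and_congr_right fun hk => ?_
      rw [if_pos hk]

/-- The number of diagrams on `n` points. -/
noncomputable def diagramCount (Λ : Finset Bool) (n : ℕ) : ℕ := (diagrams Λ (Finset.range n)).card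

/-- The number of connected diagrams on `n` points. -/
noncomputable def linkedCount (Λ : Finset Bool) (n : ℕ) : ℕ :=
  (linkedDiagrams Λ (Finset.range n)).card

theorem card_diagrams (Λ : Finset Bool) (A : Finset ℕ) :
    (diagrams Λ A).card = diagramCount Λ A.card := by
  obtain ⟨g, hg⟩ := exists_map_range_eq A
  conv_lhs => rw [← hg, diagrams_map, Finset.card_map]
  rfl

theorem card_linkedDiagrams (Λ : Finset Bool) (A : Finset ℕ) :
    (linkedDiagrams Λ A).card = linkedCount Λ A.card := by
  obtain ⟨g, hg⟩ := exists_map_range_eq A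
  conv_lhs => rw [← hg, linkedDiagrams_map, Finset.card_map]
  rfl

/-! ### The recursion for the number of diagrams -/

/-- The subsets are grouped by their largest element `v`. -/
theorem sum_powersetCard_succ_range {M : Type*} [AddCommMonoid M] (f : Finset ℕ → M) (s n : ℕ) :
    ∑ V ∈ (Finset.range n).powersetCard (s + 1), f V =
      ∑ v ∈ Finset.range n, ∑ V ∈ (Finset.range v).powersetCard s, f (insert v V) := by
  induction n with
  | zero => rw [Finset.powersetCard_eq_empty.2 (by simp)]; simp
  | succ n ih =>
    rw [Finset.sum_range_succ, ← ih, Finset.range_add_one,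
      Finset.powersetCard_succ_insert Finset.notMem_range_self, Finset.sum_union,
      Finset.sum_image]
    · intro V hV W hW h
      simp only [Finset.mem_coe, Finset.mem_powersetCard] at hV hW
      have hV' : n ∉ V := fun h => Finset.notMem_range_self (hV.1 h)
      have hW' : n ∉ W := fun h => Finset.notMem_range_self (hW.1 h)
      rw [← Finset.erase_insert hV', ← Finset.erase_insert hW']
      exact congrArg (Finset.erase · n) h
    · rw [Finset.disjoint_left]
      intro V hV hV'
      obtain ⟨W, -, rfl⟩ := Finset.mem_image.1 hV'
      exact Finset.notMem_range_self ((Finset.mem_powersetCard.1 hV).1 (Finset.mem_insert_self _ _))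

/-- The generating series of the numbers of diagrams. -/
noncomputable def diagramSeries (Λ : Finset Bool) : PowerSeries ℕ := PowerSeries.mk (diagramCount Λ)

open PowerSeries in
-- Each point of `V` contributes a factor `X`, and the gap that follows it a factor `diagramSeries
-- Λ`. There is no gap before the first point because that point is `0`. The induction removes the
-- largest point of `V` together with its gap.
theorem sum_card_gapDiagrams (Λ : Finset Bool) (s n : ℕ) :
    ∑ V ∈ ((Finset.range n).powersetCard (s + 1)).filter (0 ∈ ·),
      (gapDiagrams Λ (Finset.range n) V).card = coeff n ((X * diagramSeries Λ) ^ (s + 1)) := by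
  induction s generalizing n with
  | zero =>
    rw [Finset.sum_filter, sum_powersetCard_succ_range]
    simp only [Finset.powersetCard_zero, Finset.sum_singleton, insert_empty_eq,
      Finset.mem_singleton, zero_add, pow_one]
    rcases n with _ | n
    · simp
    · rw [Finset.sum_eq_single_of_mem 0 (by simp) (fun b _ hb => if_neg hb.symm)]
      have := card_gapDiagrams_insert (Λ := Λ) (n := n + 1) (v := 0) (V := ∅) (by omega) (by simp)
      rw [if_pos rfl, ← insert_empty_eq, this]
      simp [gapDiagrams, diagrams_empty, card_diagrams, diagramSeries, coeff_succ_X_mul]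
  | succ s ih =>
    have key : ∀ v < n, ∑ V ∈ (Finset.range v).powersetCard (s + 1),
        (if 0 ∈ insert v V then (gapDiagrams Λ (Finset.range n) (insert v V)).card else 0) =
        coeff v ((X * diagramSeries Λ) ^ (s + 1)) * diagramCount Λ (n - (v + 1)) := by
      intro v hv
      rw [← ih v, Finset.sum_mul, Finset.sum_filter]
      refine Finset.sum_congr rfl fun V hV => ?_
      obtain ⟨hVv, hVc⟩ := Finset.mem_powersetCard.1 hV
      have h0 : 0 ∈ insert v V ↔ 0 ∈ V := by
        rw [Finset.mem_insert, or_iff_right_iff_imp]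
        rintro rfl
        have : V = ∅ := Finset.subset_empty.1 hVv
        simp [this] at hVc
      rw [card_gapDiagrams_insert hv hVv, card_diagrams, Nat.card_Ico]
      simp only [h0]
    rw [Finset.sum_filter, sum_powersetCard_succ_range,
      Finset.sum_congr rfl fun v hv => key v (Finset.mem_range.1 hv)]
    rcases n with _ | n
    · simp
    · rw [pow_succ _ (s + 1), mul_left_comm, coeff_succ_X_mul, coeff_mul,
        Finset.Nat.sum_antidiagonal_eq_sum_range_succ_mk]
      refine Finset.sum_congr rfl fun v _ => ?_
      rw [diagramSeries, coeff_mk, Nat.add_sub_add_right]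

open PowerSeries in
-- This is the moment-cumulant relation with `linkedCount Λ` as free cumulants: the decomposition at
-- the component of `0`, sorted by the number `s` of its points.
theorem diagramCount_eq_sum (Λ : Finset Bool) {n : ℕ} (hn : 0 < n) :
    diagramCount Λ n =
      ∑ s ∈ Finset.Icc 1 n, linkedCount Λ s * coeff n ((X * diagramSeries Λ) ^ s) := by
  rw [diagramCount, card_diagrams_eq_sum (Finset.mem_range.2 hn)]
  simp_rw [card_linkedDiagrams]
  rw [← Finset.sum_fiberwise_of_maps_to (t := Finset.Icc 1 n) (g := Finset.card)]
  · refine Finset.sum_congr rfl fun s hs => ?_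
    obtain ⟨s, rfl⟩ : ∃ t, s = t + 1 := ⟨s - 1, by rw [Finset.mem_Icc] at hs; omega⟩
    rw [← sum_card_gapDiagrams, Finset.mul_sum]
    refine Finset.sum_congr ?_ fun V hV => ?_
    · ext V
      simp only [Finset.mem_filter, Finset.mem_powerset, Finset.mem_powersetCard]
      tauto
    · rw [(Finset.mem_powersetCard.1 (Finset.mem_filter.1 hV).1).2]
  · intro V hV
    simp only [Finset.mem_filter, Finset.mem_powerset] at hV
    have h1 := Finset.card_le_card hV.1
    rw [Finset.card_range] at h1
    exact Finset.mem_Icc.2 ⟨Finset.card_pos.2 ⟨0, hV.2⟩, h1⟩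

theorem diagramCount_zero (Λ : Finset Bool) : diagramCount Λ 0 = 1 := by
  simp [diagramCount, diagrams_empty]

/-! ### Diagrams of one colour and of two colours -/

/-- Arcs of a single colour never cross, so no chain leaves its first arc. -/
theorem IsLinked.eq_singleton {c : Bool} {A : Finset ℕ} {Q : Finset Arc}
    (h : IsDiagram {c} A Q) (hl : IsLinked Q) {e : Arc} (he : e ∈ Q) : Q = {e} := by
  have hc : ∀ x ∈ Q, x.2.2 = c := fun x hx => Finset.mem_singleton.1 (h.colour_mem x hx)
  refine Finset.eq_singleton_iff_unique_mem.2 ⟨he, fun f hf => ?_⟩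
  have : ∀ x, Linked Q e x → x = e := by
    intro x hx
    induction hx with
    | refl => rfl
    | tail _ h' ih =>
      subst ih
      exact absurd h'.2 (h.not_cross _ he _ h'.1 ((hc _ he).trans (hc _ h'.1).symm))
  exact this f (hl e he f hf)

theorem isDiagram_singleton {Λ : Finset Bool} {c : Bool} (hc : c ∈ Λ) {i j : ℕ} (hij : i < j) :
    IsDiagram Λ {i, j} {(i, j, c)} := by
  constructor <;> simp [Arc.HasEnd, Arc.Cross, hij, hc]

theorem linkedCount_singleton (c : Bool) {s : ℕ} (hs : 0 < s) :
    linkedCount {c} s = if s = 2 then 1 else 0 := by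
  have key : ∀ Q, IsDiagram {c} (Finset.range s) Q → IsLinked Q → Q = {(0, 1, c)} ∧ s = 2 := by
    intro Q h hl
    obtain ⟨e, he, -⟩ := h.cover 0 (Finset.mem_range.2 hs)
    have hQ := hl.eq_singleton h he
    have hlt := h.lt e he
    have hsupp := h.support_eq
    have hc := h.colour_mem e he
    subst hQ
    simp only [support, Finset.image_singleton, Finset.singleton_union] at hsupp
    have h2 : s = 2 := by
      rw [← Finset.card_range s, ← hsupp, Finset.card_pair hlt.ne]
    subst h2
    have h0 : e.1 ∈ Finset.range 2 := by rw [← hsupp]; simp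
    have h1 : e.2.1 ∈ Finset.range 2 := by rw [← hsupp]; simp
    rw [Finset.mem_range] at h0 h1
    rw [Finset.mem_singleton] at hc
    refine ⟨?_, rfl⟩
    congr 1
    exact Prod.ext (by simp; omega) (Prod.ext (by simp; omega) hc)
  split_ifs with h2
  · subst h2
    rw [linkedCount, Finset.card_eq_one]
    refine ⟨{(0, 1, c)}, ?_⟩
    ext Q
    rw [mem_linkedDiagrams, Finset.mem_singleton]
    refine ⟨fun h => (key Q h.1 h.2).1, ?_⟩
    rintro rfl
    refine ⟨isDiagram_singleton (Finset.mem_singleton_self c) one_pos, fun e he f hf => ?_⟩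
    rw [Finset.mem_singleton] at he hf
    rw [he, hf]
    exact .refl
  · rw [linkedCount, Finset.card_eq_zero]
    refine Finset.eq_empty_of_forall_notMem fun Q hQ => ?_
    rw [mem_linkedDiagrams] at hQ
    exact h2 (key Q hQ.1 hQ.2).2

open PowerSeries in
theorem diagramCount_singleton_one (c : Bool) : diagramCount {c} 1 = 0 := by
  rw [diagramCount_eq_sum _ one_pos]
  simp [linkedCount_singleton]

open PowerSeries in
-- With one colour the only nonzero cumulant is the second, and the relation becomes the Catalan
-- recursion.
theorem diagramCount_singleton_add_two (c : Bool) (n : ℕ) :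
    diagramCount {c} (n + 2) = ∑ k ∈ Finset.HasAntidiagonal.antidiagonal n,
      diagramCount {c} k.1 * diagramCount {c} k.2 := by
  rw [diagramCount_eq_sum _ (by omega), Finset.sum_eq_single_of_mem 2 (by simp)]
  · rw [linkedCount_singleton c two_pos, if_pos rfl, one_mul, mul_pow, coeff_X_pow_mul, sq,
      coeff_mul]
    simp [diagramSeries]
  · intro s hs h2
    rw [linkedCount_singleton c (Finset.mem_Icc.1 hs).1, if_neg h2, zero_mul]

/-- Arcs of different colours do not constrain each other, so a two-coloured diagram is a set `B` of
points with independent one-coloured diagrams on `B` and on its complement. -/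
theorem diagramCount_univ (n : ℕ) : diagramCount Finset.univ n =
    ∑ k ∈ Finset.range (n + 1), n.choose k *
      (diagramCount {true} k * diagramCount {false} (n - k)) := by
  have h1 : diagramCount Finset.univ n = ∑ B ∈ (Finset.range n).powerset,
      (diagrams {true} B).card * (diagrams {false} (Finset.range n \ B)).card := by
    simp_rw [← Finset.card_product]
    rw [← Finset.card_sigma, diagramCount]
    refine Finset.card_nbij'
      (fun Q => ⟨support (Q.filter fun e => e.2.2 = true), Q.filter fun e => e.2.2 = true,
        Q.filter fun e => e.2.2 = false⟩) (fun x => x.2.1 ∪ x.2.2) ?_ ?_ ?_ ?_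
    · intro Q hQ
      have h := mem_diagrams.1 hQ
      simp only [Finset.coe_sigma, Set.mem_sigma_iff, Finset.mem_coe, Finset.mem_powerset,
        Finset.mem_product, mem_diagrams]
      refine ⟨?_, ?_, ?_⟩
      · intro a ha
        obtain ⟨e, he, hea⟩ := mem_support.1 ha
        exact h.hasEnd_mem (Finset.mem_of_mem_filter e he) hea
      · exact (h.restrict_support (Finset.filter_subset _ _)).restrict_colours (by simp)
      · have := h.sdiff (Finset.filter_subset (fun e : Arc => e.2.2 = true) Q)
        rw [← Finset.filter_not] at this
        simp only [Bool.not_eq_true] at this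
        exact this.restrict_colours (by simp)
    · rintro ⟨B, P, R⟩ hx
      simp only [Finset.coe_sigma, Set.mem_sigma_iff, Finset.mem_coe, Finset.mem_powerset,
        Finset.mem_product, mem_diagrams] at hx ⊢
      obtain ⟨hB, hP, hR⟩ := hx
      have := (hP.restrict_colours (Λ' := Finset.univ) (by simp)).union
        (hR.restrict_colours (Λ' := Finset.univ) (by simp)) Finset.disjoint_sdiff
        fun e he f hf hef => absurd hef ?_
      · rwa [Finset.union_sdiff_of_subset hB] at this
      · rw [Finset.mem_singleton.1 (hP.colour_mem e he),
          Finset.mem_singleton.1 (hR.colour_mem f hf)]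
        simp
    · intro Q _
      ext e
      simp only [Finset.mem_union, Finset.mem_filter]
      cases e.2.2 <;> simp
    · rintro ⟨B, P, R⟩ hx
      simp only [Finset.coe_sigma, Set.mem_sigma_iff, Finset.mem_coe, Finset.mem_powerset,
        Finset.mem_product, mem_diagrams] at hx
      obtain ⟨hB, hP, hR⟩ := hx
      have hPc : ∀ e ∈ P, e.2.2 = true := fun e he => Finset.mem_singleton.1 (hP.colour_mem e he)
      have hRc : ∀ e ∈ R, e.2.2 = false := fun e he => Finset.mem_singleton.1 (hR.colour_mem e he)
      have h1 : (P ∪ R).filter (fun e => e.2.2 = true) = P := by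
        ext e
        have := hPc e
        have := hRc e
        simp only [Finset.mem_filter, Finset.mem_union]
        grind
      have h2 : (P ∪ R).filter (fun e => e.2.2 = false) = R := by
        ext e
        have := hPc e
        have := hRc e
        simp only [Finset.mem_filter, Finset.mem_union]
        grind
      simp only [h1, h2, hP.support_eq]
  rw [h1, Finset.sum_powerset]
  simp only [Finset.card_range]
  refine Finset.sum_congr rfl fun k _ => ?_
  have h2 := Finset.sum_powersetCard k (Finset.range n)
    fun k => diagramCount {true} k * diagramCount {false} (n - k)
  rw [Finset.card_range, smul_eq_mul] at h2
  rw [← h2]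
  refine Finset.sum_congr rfl fun B hB => ?_
  rw [card_diagrams, card_diagrams, Finset.card_sdiff_of_subset (Finset.mem_powersetCard.1 hB).1,
    Finset.card_range]

/-! ### Connected two-coloured diagrams and pair partitions -/

instance (e : Arc) : DecidablePred e.HasEnd := fun _ => inferInstanceAs (Decidable (_ ∨ _))

/-- The pair of ends of an arc, as a subset of `Fin s`. -/
def block (s : ℕ) (e : Arc) : Finset (Fin s) := Finset.univ.filter fun a => e.HasEnd a

section

variable {s : ℕ} {Λ : Finset Bool} {Q : Finset Arc}

theorem mem_block {e : Arc} {a : Fin s} : a ∈ block s e ↔ e.HasEnd a := by simp [block]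

theorem block_eq_pair {e : Arc} (h1 : e.1 < s) (h2 : e.2.1 < s) :
    block s e = {⟨e.1, h1⟩, ⟨e.2.1, h2⟩} := by
  ext a
  simp only [mem_block, Arc.HasEnd, Finset.mem_insert, Finset.mem_singleton, Fin.ext_iff]
  omega

theorem card_block {e : Arc} (h1 : e.1 < s) (h2 : e.2.1 < s) (h : e.1 < e.2.1) :
    (block s e).card = 2 := by
  rw [block_eq_pair h1 h2, Finset.card_pair]
  simp only [ne_eq, Fin.mk.injEq]
  omega

theorem ends_eq_of_block_eq {e f : Arc} (he : e.1 < e.2.1) (he' : e.2.1 < s) (hf : f.1 < f.2.1)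
    (h : block s e = block s f) : e.1 = f.1 ∧ e.2.1 = f.2.1 := by
  have h1 : f.HasEnd e.1 := (mem_block (a := ⟨e.1, he.trans he'⟩)).1 (h ▸ mem_block.2 (.inl rfl))
  have h2 : f.HasEnd e.2.1 := (mem_block (a := ⟨e.2.1, he'⟩)).1 (h ▸ mem_block.2 (.inr rfl))
  simp only [Arc.HasEnd] at h1 h2
  omega

theorem crosses_block {e f : Arc} (he : e.1 < e.2.1) (he' : e.2.1 < s) (hf : f.1 < f.2.1)
    (hf' : f.2.1 < s) : Crosses (block s e) (block s f) ↔
      e.1 < f.1 ∧ f.1 < e.2.1 ∧ e.2.1 < f.2.1 := by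
  constructor
  · rintro ⟨v₁, hv₁, v₂, hv₂, w₁, hw₁, w₂, hw₂, h1, h2, h3⟩
    simp only [mem_block, Arc.HasEnd, Fin.lt_def] at *
    omega
  · rintro ⟨h1, h2, h3⟩
    exact ⟨⟨e.1, he.trans he'⟩, mem_block.2 (.inl rfl), ⟨e.2.1, he'⟩, mem_block.2 (.inr rfl),
      ⟨f.1, hf.trans hf'⟩, mem_block.2 (.inl rfl), ⟨f.2.1, hf'⟩, mem_block.2 (.inr rfl), h1, h2, h3⟩

/-- `SimpleGraph.fromRel` symmetrizes the relation and requires distinct vertices; crossing arcs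
have distinct blocks because their left ends differ. -/
theorem intersectionGraph_adj_iff {π : Finpartition (Finset.univ : Finset (Fin s))} {e f : Arc}
    (he : e.1 < e.2.1) (he' : e.2.1 < s) (hf : f.1 < f.2.1) (hf' : f.2.1 < s)
    (hV : block s e ∈ π.parts) (hW : block s f ∈ π.parts) :
    (intersectionGraph π).Adj ⟨block s e, hV⟩ ⟨block s f, hW⟩ ↔ e.Cross f := by
  rw [intersectionGraph, SimpleGraph.fromRel_adj, crosses_block he he' hf hf',
    crosses_block hf hf' he he', Arc.Cross, and_iff_right_iff_imp]
  intro h heq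
  have := ends_eq_of_block_eq he he' hf (congrArg Subtype.val heq)
  omega

theorem IsDiagram.bounds (h : IsDiagram Λ (Finset.range s) Q) {e : Arc} (he : e ∈ Q) :
    e.1 < e.2.1 ∧ e.2.1 < s :=
  ⟨h.lt e he, Finset.mem_range.1 (h.snd_mem e he)⟩

/-- The partition of the points into the pairs of ends of the arcs of a diagram. -/
def IsDiagram.partition (h : IsDiagram Λ (Finset.range s) Q) :
    Finpartition (Finset.univ : Finset (Fin s)) :=
  Finpartition.ofExistsUnique (Q.image (block s)) (fun _ _ => Finset.subset_univ _)
    (fun a _ => by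
      obtain ⟨e, he, hea⟩ := h.cover a (Finset.mem_range.2 a.2)
      refine ⟨block s e, ⟨Finset.mem_image_of_mem _ he, mem_block.2 hea⟩, ?_⟩
      rintro _ ⟨hV, haV⟩
      obtain ⟨f, hf, rfl⟩ := Finset.mem_image.1 hV
      rw [h.inj e he f hf a hea (mem_block.1 haV)])
    (fun h0 => by
      obtain ⟨e, he, he0⟩ := Finset.mem_image.1 h0
      have hb := h.bounds he
      have := card_block (hb.1.trans hb.2) hb.2 hb.1
      rw [he0] at this
      simp at this)

theorem IsDiagram.mem_partition (h : IsDiagram Λ (Finset.range s) Q) {V : Finset (Fin s)} :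
    V ∈ h.partition.parts ↔ ∃ e ∈ Q, block s e = V := by
  simp [IsDiagram.partition, Finpartition.ofExistsUnique]

theorem IsDiagram.block_mem_partition (h : IsDiagram Λ (Finset.range s) Q) {e : Arc}
    (he : e ∈ Q) : block s e ∈ h.partition.parts := h.mem_partition.2 ⟨e, he, rfl⟩

theorem IsDiagram.adj_partition (h : IsDiagram Λ (Finset.range s) Q) {e f : Arc}
    (he : e ∈ Q) (hf : f ∈ Q) : (intersectionGraph h.partition).Adj
      ⟨block s e, h.block_mem_partition he⟩ ⟨block s f, h.block_mem_partition hf⟩ ↔ e.Cross f :=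
  intersectionGraph_adj_iff (h.bounds he).1 (h.bounds he).2 (h.bounds hf).1 (h.bounds hf).2 _ _

/-- The colours of the arcs form a proper 2-colouring of the intersection graph, and chains of
crossings become walks in it. Positivity of `s` gives a vertex, which connectedness requires. -/
theorem IsDiagram.partition_mem (h : IsDiagram Λ (Finset.range s) Q) (hl : IsLinked Q)
    (hs : 0 < s) : h.partition ∈ biconPairPartitions s := by
  refine ⟨?_, ?_, ?_⟩
  · intro V hV
    obtain ⟨e, he, rfl⟩ := h.mem_partition.1 hV
    have hb := h.bounds he
    exact card_block (hb.1.trans hb.2) hb.2 hb.1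
  · have hchoose : ∀ V : {V // V ∈ h.partition.parts}, ∃ e, e ∈ Q ∧ block s e = V.1 := fun V => by
      obtain ⟨e, he, h'⟩ := h.mem_partition.1 V.2
      exact ⟨e, he, h'⟩
    choose arc harc hblock using hchoose
    let C : (intersectionGraph h.partition).Coloring Bool :=
      SimpleGraph.Coloring.mk (fun V => (arc V).2.2) fun {V W} hVW heq => by
        refine h.not_cross _ (harc V) _ (harc W) heq ?_
        rw [← h.adj_partition (harc V) (harc W)]
        convert hVW
        · exact hblock V
        · exact hblock W
    exact C.colorable
  · have key : ∀ e (he : e ∈ Q) f, Linked Q e f → ∃ hf : f ∈ Q,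
        (intersectionGraph h.partition).Reachable ⟨block s e, h.block_mem_partition he⟩
          ⟨block s f, h.block_mem_partition hf⟩ := by
      intro e he f hef
      induction hef with
      | refl => exact ⟨he, .refl _⟩
      | tail _ hst ih =>
        obtain ⟨hf, hr⟩ := ih
        exact ⟨hst.1, hr.trans ((h.adj_partition hf hst.1).2 hst.2).reachable⟩
    have hne : Nonempty {V // V ∈ h.partition.parts} := by
      obtain ⟨e, he, -⟩ := h.cover 0 (Finset.mem_range.2 hs)
      exact ⟨⟨_, h.block_mem_partition he⟩⟩
    refine ⟨?_⟩
    rintro ⟨V, hV⟩ ⟨W, hW⟩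
    obtain ⟨e, he, rfl⟩ := h.mem_partition.1 hV
    obtain ⟨f, hf, rfl⟩ := h.mem_partition.1 hW
    exact (key e he f (hl e he f hf)).2

open Classical in
/-- Whether the arc at the point `0` has the colour `true`. -/
noncomputable def zeroColour (Q : Finset Arc) : Bool := decide (∃ e ∈ Q, e.1 = 0 ∧ e.2.2 = true)

theorem IsDiagram.zeroColour_eq (h : IsDiagram Λ (Finset.range s) Q) {e : Arc} (he : e ∈ Q)
    (he0 : e.1 = 0) : zeroColour Q = e.2.2 := by
  rw [zeroColour, Bool.eq_iff_iff, decide_eq_true_eq]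
  refine ⟨?_, fun hc => ⟨e, he, he0, hc⟩⟩
  rintro ⟨f, hf, hf0, hc⟩
  rwa [h.inj e he f hf 0 (.inl he0) (.inl hf0)]

theorem IsDiagram.exists_zero (h : IsDiagram Λ (Finset.range s) Q) (hs : 0 < s) :
    ∃ e ∈ Q, e.1 = 0 := by
  obtain ⟨e, he, h0⟩ := h.cover 0 (Finset.mem_range.2 hs)
  have := h.lt e he
  exact ⟨e, he, by simp only [Arc.HasEnd] at h0; omega⟩

/-- With two colours available, the colour of an arc forces the opposite colour on every arc that
crosses it. Along chains from the arc at `0`, the partition and `zeroColour` therefore determine a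
connected diagram. -/
theorem subset_of_partition_eq {P : Finset Arc} (hQ : IsDiagram Λ (Finset.range s) Q)
    (hP : IsDiagram Λ (Finset.range s) P) (hl : IsLinked Q) (hs : 0 < s)
    (hπ : hQ.partition = hP.partition) (hc : zeroColour Q = zeroColour P) : Q ⊆ P := by
  have hex : ∀ e ∈ Q, ∃ f ∈ P, e.1 = f.1 ∧ e.2.1 = f.2.1 := by
    intro e he
    have := hQ.block_mem_partition he
    rw [hπ, hP.mem_partition] at this
    obtain ⟨f, hf, hfe⟩ := this
    have h1 := hQ.bounds he
    have h2 := hP.bounds hf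
    exact ⟨f, hf, ends_eq_of_block_eq h1.1 h1.2 h2.1 hfe.symm⟩
  obtain ⟨x, hx, hx0⟩ := hQ.exists_zero hs
  intro e he
  have hxe := hl x hx e he
  clear he
  induction hxe with
  | refl =>
    obtain ⟨y, hy, h1, h2⟩ := hex x hx
    have : x = y := by
      refine Prod.ext h1 (Prod.ext h2 ?_)
      rw [← hQ.zeroColour_eq hx hx0, hc, hP.zeroColour_eq hy (h1 ▸ hx0)]
    exact this ▸ hy
  | @tail e f hxe hef ih =>
    obtain ⟨g, hg, h1, h2⟩ := hex f hef.1
    have heQ : e ∈ Q := (Linked.symm hx hxe).1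
    have h3 : e.2.2 ≠ f.2.2 := fun h => hQ.not_cross e heQ f hef.1 h hef.2
    have h4 : e.2.2 ≠ g.2.2 := fun h => hP.not_cross e ih g hg h (by
      have := hef.2
      simp only [Arc.Cross, h1, h2] at this ⊢
      exact this)
    have : f = g := by
      refine Prod.ext h1 (Prod.ext h2 ?_)
      revert h3 h4
      cases e.2.2 <;> cases f.2.2 <;> cases g.2.2 <;> simp
    exact this ▸ hg

open Classical in
/-- The diagram of a pair partition with coloured blocks. -/
noncomputable def diagramOfPartition (π : Finpartition (Finset.univ : Finset (Fin s)))
    (c : {V // V ∈ π.parts} → Bool) : Finset Arc :=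
  (Finset.range s ×ˢ Finset.range s ×ˢ Finset.univ).filter fun e =>
    e.1 < e.2.1 ∧ ∃ h : block s e ∈ π.parts, c ⟨block s e, h⟩ = e.2.2

theorem mem_diagramOfPartition {π : Finpartition (Finset.univ : Finset (Fin s))}
    {c : {V // V ∈ π.parts} → Bool} {e : Arc} : e ∈ diagramOfPartition π c ↔
      e.1 < e.2.1 ∧ e.2.1 < s ∧ ∃ h : block s e ∈ π.parts, c ⟨block s e, h⟩ = e.2.2 := by
  simp only [diagramOfPartition, Finset.mem_filter, Finset.mem_product, Finset.mem_range,
    Finset.mem_univ, and_true]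
  constructor
  · rintro ⟨⟨-, h2⟩, h1, h3⟩
    exact ⟨h1, h2, h3⟩
  · rintro ⟨h1, h2, h3⟩
    exact ⟨⟨h1.trans h2, h2⟩, h1, h3⟩

theorem exists_arc_of_mem_parts {π : Finpartition (Finset.univ : Finset (Fin s))}
    (c : {V // V ∈ π.parts} → Bool) {V : Finset (Fin s)} (hV : V ∈ π.parts) (h2 : V.card = 2) :
    ∃ e ∈ diagramOfPartition π c, block s e = V := by
  have key : ∀ x y : Fin s, x < y → V = {x, y} → ∃ e ∈ diagramOfPartition π c, block s e = V := by
    intro x y hxy hVxy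
    have hb : block s (x, y, c ⟨V, hV⟩) = V := by
      exact (block_eq_pair x.2 y.2).trans hVxy.symm
    refine ⟨(x, y, c ⟨V, hV⟩), mem_diagramOfPartition.2 ⟨hxy, y.2, by rwa [hb], ?_⟩, hb⟩
    simp only [hb]
  obtain ⟨x, y, hxy, hVxy⟩ := Finset.card_eq_two.1 h2
  rcases lt_or_gt_of_ne hxy with h | h
  · exact key x y h hVxy
  · exact key y x h (by rw [hVxy, Finset.pair_comm])

theorem isDiagram_diagramOfPartition {π : Finpartition (Finset.univ : Finset (Fin s))}
    (hπ : ∀ V ∈ π.parts, V.card = 2) {c : {V // V ∈ π.parts} → Bool}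
    (hc : ∀ V W, (intersectionGraph π).Adj V W → c V ≠ c W) :
    IsDiagram Finset.univ (Finset.range s) (diagramOfPartition π c) where
  lt e he := (mem_diagramOfPartition.1 he).1
  fst_mem e he := Finset.mem_range.2
    ((mem_diagramOfPartition.1 he).1.trans (mem_diagramOfPartition.1 he).2.1)
  snd_mem e he := Finset.mem_range.2 (mem_diagramOfPartition.1 he).2.1
  colour_mem _ _ := Finset.mem_univ _
  cover a ha := by
    obtain ⟨V, ⟨hV, haV⟩, -⟩ := π.existsUnique_mem
      (Finset.mem_univ (⟨a, Finset.mem_range.1 ha⟩ : Fin s))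
    obtain ⟨e, he, rfl⟩ := exists_arc_of_mem_parts c hV (hπ V hV)
    exact ⟨e, he, mem_block.1 haV⟩
  inj e he f hf a hea hfa := by
    obtain ⟨he1, he2, he3, he4⟩ := mem_diagramOfPartition.1 he
    obtain ⟨hf1, hf2, hf3, hf4⟩ := mem_diagramOfPartition.1 hf
    have ha : a < s := by
      simp only [Arc.HasEnd] at hea
      omega
    have hb : block s e = block s f := π.eq_of_mem_parts he3 hf3
      (mem_block (a := ⟨a, ha⟩).2 hea) (mem_block.2 hfa)
    have := ends_eq_of_block_eq he1 he2 hf1 hb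
    refine Prod.ext this.1 (Prod.ext this.2 ?_)
    rw [← he4, ← hf4]
    simp only [hb]
  not_cross e he f hf hef hcr := by
    obtain ⟨he1, he2, he3, he4⟩ := mem_diagramOfPartition.1 he
    obtain ⟨hf1, hf2, hf3, hf4⟩ := mem_diagramOfPartition.1 hf
    exact hc _ _ ((intersectionGraph_adj_iff he1 he2 hf1 hf2 he3 hf3).2 hcr)
      (he4.trans (hef.trans hf4.symm))

/-- A walk in the intersection graph lifts, block by block, to a chain of crossing arcs. -/
theorem isLinked_diagramOfPartition {π : Finpartition (Finset.univ : Finset (Fin s))}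
    (hπ : ∀ V ∈ π.parts, V.card = 2) {c : {V // V ∈ π.parts} → Bool}
    (hc : ∀ V W, (intersectionGraph π).Adj V W → c V ≠ c W)
    (hconn : (intersectionGraph π).Connected) : IsLinked (diagramOfPartition π c) := by
  have hd := isDiagram_diagramOfPartition hπ hc
  have key : ∀ V W, (intersectionGraph π).Walk V W → ∀ e ∈ diagramOfPartition π c,
      ∀ f ∈ diagramOfPartition π c, block s e = V.1 → block s f = W.1 →
        Linked (diagramOfPartition π c) e f := by
    intro V W p
    induction p with
    | @nil V =>
      intro e he f hf heV hfV
      have h1 := hd.bounds he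
      have hm : (⟨e.1, h1.1.trans h1.2⟩ : Fin s) ∈ block s f := by
        rw [hfV, ← heV]
        exact mem_block.2 (.inl rfl)
      rw [hd.inj e he f hf e.1 (.inl rfl) (mem_block.1 hm)]
      exact .refl
    | @cons V U W hVU p ih =>
      intro e he f hf heV hfW
      obtain ⟨g, hg, hgU⟩ := exists_arc_of_mem_parts c U.2 (hπ _ U.2)
      refine Relation.ReflTransGen.head ⟨hg, ?_⟩ (ih g hg f hf hgU hfW)
      obtain ⟨V, hV⟩ := V
      obtain ⟨U, hU⟩ := U
      simp only at heV hgU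
      subst heV hgU
      have h1 := hd.bounds he
      have h2 := hd.bounds hg
      exact (intersectionGraph_adj_iff h1.1 h1.2 h2.1 h2.2 hV hU).1 hVU
  intro e he f hf
  obtain ⟨p⟩ := hconn.preconnected ⟨_, (mem_diagramOfPartition.1 he).2.2.1⟩
    ⟨_, (mem_diagramOfPartition.1 hf).2.2.1⟩
  exact key _ _ p e he f hf rfl rfl

theorem partition_diagramOfPartition {π : Finpartition (Finset.univ : Finset (Fin s))}
    (hπ : ∀ V ∈ π.parts, V.card = 2) {c : {V // V ∈ π.parts} → Bool}
    (hc : ∀ V W, (intersectionGraph π).Adj V W → c V ≠ c W) :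
    (isDiagram_diagramOfPartition hπ hc).partition = π := by
  refine Finpartition.ext (Finset.ext fun V => ?_)
  rw [IsDiagram.mem_partition]
  constructor
  · rintro ⟨e, he, rfl⟩
    exact (mem_diagramOfPartition.1 he).2.2.1
  · intro hV
    exact exists_arc_of_mem_parts c hV (hπ V hV)

end

/-- Recolouring by agreement with the colour of `v` lets the value at `v` be prescribed. -/
theorem exists_colouring {V : Type*} {G : SimpleGraph V} (hG : G.IsBipartite) (v : V) (b : Bool) :
    ∃ c : V → Bool, (∀ u w, G.Adj u w → c u ≠ c w) ∧ c v = b := by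
  obtain ⟨C⟩ := hG
  refine ⟨fun u => if C u = C v then b else !b, fun u w huw => ?_, if_pos rfl⟩
  have h := C.valid huw
  have h2 : ∀ x y z : Fin 2, x ≠ y → ((x = z ∧ y ≠ z) ∨ (x ≠ z ∧ y = z)) := by decide
  rcases h2 _ _ (C v) h with ⟨h1, h2⟩ | ⟨h1, h2⟩ <;> simp [h1, h2]

/-- A connected diagram corresponds to its underlying partition and the colour of its arc at `0`;
the factor `2` counts the choices of that colour. -/
theorem linkedCount_univ {s : ℕ} (hs : 0 < s) :
    linkedCount Finset.univ s = 2 * (biconPairPartitions s).ncard := by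
  have h1 : (biconPairPartitions s ×ˢ (Set.univ : Set Bool)).ncard =
      (biconPairPartitions s).ncard * 2 := by
    rw [Set.ncard_prod, Set.ncard_univ, Nat.card_eq_fintype_card, Fintype.card_bool]
  rw [mul_comm, ← h1, linkedCount, ← Set.ncard_coe_finset]
  refine Set.ncard_congr
    (fun Q hQ => ((mem_linkedDiagrams.1 (Finset.mem_coe.1 hQ)).1.partition, zeroColour Q)) ?_ ?_ ?_
  · intro Q hQ
    exact ⟨(mem_linkedDiagrams.1 hQ).1.partition_mem (mem_linkedDiagrams.1 hQ).2 hs, Set.mem_univ _⟩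
  · intro Q P hQ hP h
    rw [Prod.mk.injEq] at h
    exact (subset_of_partition_eq _ _ (mem_linkedDiagrams.1 hQ).2 hs h.1 h.2).antisymm
      (subset_of_partition_eq _ _ (mem_linkedDiagrams.1 hP).2 hs h.1.symm h.2.symm)
  · rintro ⟨π, b⟩ ⟨⟨hπ, hbip, hconn⟩, -⟩
    simp only at hπ hbip hconn
    obtain ⟨V, ⟨hV, h0V⟩, -⟩ := π.existsUnique_mem (Finset.mem_univ (⟨0, hs⟩ : Fin s))
    obtain ⟨c, hc, hcV⟩ := exists_colouring hbip ⟨V, hV⟩ b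
    refine ⟨diagramOfPartition π c, mem_linkedDiagrams.2 ⟨isDiagram_diagramOfPartition hπ hc,
      isLinked_diagramOfPartition hπ hc hconn⟩, ?_⟩
    rw [Prod.mk.injEq]
    refine ⟨partition_diagramOfPartition hπ hc, ?_⟩
    obtain ⟨e, he, rfl⟩ := exists_arc_of_mem_parts c hV (hπ V hV)
    have hd := isDiagram_diagramOfPartition hπ hc
    have h0 := mem_block.1 h0V
    have := hd.lt e he
    simp only [Arc.HasEnd] at h0
    rw [hd.zeroColour_eq he (by omega), ← hcV]
    exact (mem_diagramOfPartition.1 he).2.2.2.symm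

theorem biconPairPartitions_of_odd {s : ℕ} (hs : Odd s) : biconPairPartitions s = ∅ := by
  refine Set.eq_empty_of_forall_notMem fun π hπ => ?_
  have := π.sum_card_parts
  rw [Finset.sum_congr rfl hπ.1, Finset.sum_const, smul_eq_mul, Finset.card_univ,
    Fintype.card_fin] at this
  exact Nat.not_even_iff_odd.2 hs ⟨π.parts.card, by omega⟩

/-! ### Generating series -/

section

open PowerSeries

theorem coeff_pow_eq_sum_antidiagonalTuple {R : Type*} [CommSemiring R] (φ : PowerSeries R)
    (k n : ℕ) : coeff n (φ ^ k) =
      ∑ x ∈ Finset.Nat.antidiagonalTuple k n, ∏ i, coeff (x i) φ := by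
  have h : φ ^ k = ∏ _i : Fin k, φ := by simp
  rw [h, coeff_prod]
  refine Finset.sum_nbij' (fun l => ⇑l) (fun x => Finsupp.equivFunOnFinite.symm x) ?_ ?_ ?_ ?_ ?_
  · intro l hl
    rw [Finset.mem_finsuppAntidiag] at hl
    exact Finset.Nat.mem_antidiagonalTuple.2 hl.1
  · intro x hx
    rw [Finset.mem_finsuppAntidiag]
    exact ⟨Finset.Nat.mem_antidiagonalTuple.1 hx, Finset.subset_univ _⟩
  · intro l _
    exact Finsupp.equivFunOnFinite.symm_apply_apply l
  · intro x _
    rfl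
  · intro l _
    rfl

theorem coeff_X_mul_pow_of_le {R : Type*} [CommSemiring R] (φ : PowerSeries R) {s n : ℕ}
    (h : s ≤ n) : coeff n ((X * φ) ^ s) = coeff (n - s) (φ ^ s) := by
  rw [mul_pow, coeff_X_pow_mul', if_pos h]

theorem coeff_X_mul_pow_of_lt {R : Type*} [CommSemiring R] (φ : PowerSeries R) {s n : ℕ}
    (h : n < s) : coeff n ((X * φ) ^ s) = 0 := by
  rw [mul_pow, coeff_X_pow_mul', if_neg (by omega)]

/-- `κ` is the sequence of free cumulants of the sequence of moments with generating
series `A`. -/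
def HasFreeCumulants {K : Type*} [Field K] (A : PowerSeries K) (κ : ℕ → K) : Prop :=
  coeff 0 A = 1 ∧ ∀ n, 0 < n → coeff n A = ∑ s ∈ Finset.Icc 1 n, κ s * coeff n ((X * A) ^ s)

/-- Terms with `s > n` do not reach the coefficient of `X ^ n`, so one finite sum up to `N` serves
all coefficients below `N`. -/
theorem HasFreeCumulants.dvd {K : Type*} [Field K] {A : PowerSeries K} {κ : ℕ → K}
    (h : HasFreeCumulants A κ) (N : ℕ) :
    X ^ N ∣ A - (1 + ∑ s ∈ Finset.Icc 1 N, C (κ s) * (X * A) ^ s) := by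
  rw [X_pow_dvd_iff]
  intro n hn
  rw [map_sub, map_add, map_sum, sub_eq_zero]
  simp only [coeff_C_mul]
  rcases Nat.eq_zero_or_pos n with rfl | hpos
  · rw [h.1, Finset.sum_eq_zero]
    · simp
    · intro s hs
      rw [coeff_X_mul_pow_of_lt _ (Finset.mem_Icc.1 hs).1, mul_zero]
  · rw [h.2 n hpos, coeff_one, if_neg hpos.ne', zero_add]
    refine Finset.sum_subset (Finset.Icc_subset_Icc_right hn.le) fun s hs hs' => ?_
    rw [coeff_X_mul_pow_of_lt, mul_zero]
    simp only [Finset.mem_Icc] at hs hs'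
    omega

/-- Adding a free semicircular element of variance `v` to an element with free cumulants `κ`
adds `v` to the second free cumulant. -/
theorem coeff_eq_of_semicircular_perturbation {K : Type*} [Field K] {A : PowerSeries K} {κ : ℕ → K}
    (hA : HasFreeCumulants A κ) (v : K) (F : ℕ → ℕ → K) (h0 : ∀ k, F 0 k = coeff k A)
    (h1 : ∀ k, F 1 k = F 0 (k + 1))
    (h2 : ∀ n k, F (n + 2) k = F (n + 1) (k + 1) +
      v * ∑ p ∈ Finset.HasAntidiagonal.antidiagonal n, F p.1 0 * F p.2 k)
    {n : ℕ} (hn : 0 < n) :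
    F n 0 = v * coeff n (X ^ 2 * mk (fun n => F n 0) ^ 2) +
      ∑ s ∈ Finset.Icc 1 n, κ s * coeff n ((X * mk (fun n => F n 0)) ^ s) := by
  let f : ℕ → PowerSeries K := fun k => mk fun n => F n k
  set M : PowerSeries K := mk fun n => F n 0 with hM
  -- The recursion in `n` as an identity of series. The unit `u = 1 - v X² M` collects the terms in
  -- `f k`, leaving `u f_k = A_k + X f_{k+1}`.
  have hf : ∀ k, f k = C (coeff k A) + X * f (k + 1) + C v * (X ^ 2 * (M * f k)) := by
    intro k
    ext n
    rw [map_add, map_add, coeff_C_mul, coeff_C]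
    rcases n with _ | _ | n
    · simp [f, h0]
    · rw [coeff_succ_X_mul, coeff_X_pow_mul']
      simp [f, h1]
    · rw [coeff_succ_X_mul, show n + 1 + 1 = n + 2 from rfl, coeff_X_pow_mul, coeff_mul]
      simp [f, hM, h2]
  set u : PowerSeries K := 1 - C v * (X ^ 2 * M) with hu
  have hu0 : constantCoeff u ≠ 0 := by simp [hu]
  set y : PowerSeries K := X * u⁻¹ with hy
  have huy : u * y = X := by rw [hy, mul_left_comm, PowerSeries.mul_inv_cancel _ hu0, mul_one]
  have huf : ∀ k, u * f k = C (coeff k A) + X * f (k + 1) := by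
    intro k
    have := hf k
    rw [hu]
    linear_combination this
  -- Iteration from `f 0 = M` yields `u M = A(y)` with `y = X / u`, up to a remainder divisible by
  -- `X ^ N`. Substituting `y` into `A = 1 + ∑ κ_s (X A)^s` and using `y A(y) = X M` then gives `u M
  -- = 1 + ∑ κ_s (X M)^s`.
  have hsum : ∀ N, u * M = ∑ k ∈ Finset.range N, C (coeff k A) * y ^ k + u * (y ^ N * f N) := by
    intro N
    induction N with
    | zero => simp [f, hM]
    | succ N ih =>
      rw [ih, Finset.sum_range_succ, pow_succ]
      linear_combination y ^ N * huf N - y ^ N * f (N + 1) * huy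
  set N := n + 1
  let P : Polynomial K := ∑ k ∈ Finset.range N, Polynomial.C (coeff k A) * Polynomial.X ^ k
  have hAP : X ^ N ∣ A - (P : PowerSeries K) := by
    rw [X_pow_dvd_iff]
    intro m hm
    simp [P, Polynomial.finsetSum_coeff, Polynomial.coeff_X_pow, hm]
  have hP : Polynomial.X ^ N ∣
      P - (1 + ∑ s ∈ Finset.Icc 1 N, Polynomial.C (κ s) * (Polynomial.X * P) ^ s) := by
    rw [Polynomial.X_pow_dvd_iff]
    have : X ^ N ∣ ((P - (1 + ∑ s ∈ Finset.Icc 1 N, Polynomial.C (κ s) * (Polynomial.X * P) ^ s) :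
        Polynomial K) : PowerSeries K) := by
      let q := Ideal.Quotient.mk (Ideal.span {(X : PowerSeries K) ^ N})
      have e1 : q A = q P := Ideal.Quotient.eq.2 (Ideal.mem_span_singleton.2 hAP)
      have e2 : q A = q (1 + ∑ s ∈ Finset.Icc 1 N, C (κ s) * (X * A) ^ s) :=
        Ideal.Quotient.eq.2 (Ideal.mem_span_singleton.2 (hA.dvd N))
      rw [← Ideal.mem_span_singleton, ← Ideal.Quotient.eq_zero_iff_mem]
      change q _ = 0
      rw [Polynomial.coe_sub, map_sub, ← e1, e2, ← map_sub]
      rw [← Polynomial.coeToPowerSeries.ringHom_apply]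
      simp only [map_sub, map_add, map_one, map_sum, map_mul, map_pow, e1,
        Polynomial.coeToPowerSeries.ringHom_apply, Polynomial.coe_C, Polynomial.coe_X, sub_self]
    intro m hm
    rw [← Polynomial.coeff_coe]
    exact X_pow_dvd_iff.1 this m hm
  let q := Ideal.Quotient.mk (Ideal.span {(X : PowerSeries K) ^ N})
  have hqX : q (X ^ N) = 0 :=
    Ideal.Quotient.eq_zero_iff_mem.2 (Ideal.mem_span_singleton_self _)
  have hPy : Polynomial.aeval y P = ∑ k ∈ Finset.range N, C (coeff k A) * y ^ k := by
    simp [P, Polynomial.aeval_def]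
  have e1 : q (u * M) = q (Polynomial.aeval y P) := by
    rw [hsum N, hPy, map_add, add_eq_left, hy, mul_pow, map_mul, map_mul, map_mul, hqX]
    simp
  have e2 : q (Polynomial.aeval y P) =
      1 + ∑ s ∈ Finset.Icc 1 N, q (C (κ s)) * (q y * q (Polynomial.aeval y P)) ^ s := by
    obtain ⟨R, hR⟩ := hP
    have h3 := congrArg (fun p => q (Polynomial.aeval y p)) hR
    simp only [map_sub, map_add, map_one, map_sum, map_mul, map_pow, Polynomial.aeval_X,
      Polynomial.aeval_C] at h3
    rw [sub_eq_iff_eq_add] at h3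
    have : q y ^ N = 0 := by rw [← map_pow, hy, mul_pow, map_mul, hqX, zero_mul]
    rw [this, zero_mul, zero_add] at h3
    exact h3
  have e3 : q y * q (u * M) = q (X * M) := by
    rw [← map_mul]
    exact congrArg q (by linear_combination M * huy)
  rw [← e1, e3] at e2
  have e4 : X ^ N ∣ u * M - (1 + ∑ s ∈ Finset.Icc 1 N, C (κ s) * (X * M) ^ s) := by
    rw [← Ideal.mem_span_singleton, ← Ideal.Quotient.eq, map_add, map_one, map_sum]
    simp only [map_mul, map_pow]
    simpa only [map_mul] using e2
  have e5 := X_pow_dvd_iff.1 e4 n (Nat.lt_succ_self n)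
  rw [map_sub, map_add, map_sum, sub_eq_zero, coeff_one, if_neg hn.ne', zero_add, hu, sub_mul,
    one_mul, map_sub, Finset.sum_Icc_succ_top (by omega)] at e5
  simp only [coeff_C_mul, mul_assoc, coeff_X_mul_pow_of_lt _ (Nat.lt_succ_self n), mul_zero,
    add_zero, ← sq] at e5
  rw [← e5]
  simp [hM]

end

theorem sum_antidiagonal_antidiagonal {M : Type*} [AddCommMonoid M] (f : ℕ → ℕ → ℕ → M) (n : ℕ) :
    ∑ p ∈ Finset.HasAntidiagonal.antidiagonal n,
        ∑ r ∈ Finset.HasAntidiagonal.antidiagonal p.2, f p.1 r.1 r.2 =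
      ∑ p ∈ Finset.HasAntidiagonal.antidiagonal n,
        ∑ r ∈ Finset.HasAntidiagonal.antidiagonal p.1, f r.1 r.2 p.2 := by
  rw [Finset.sum_sigma', Finset.sum_sigma']
  refine Finset.sum_nbij' (fun x => ⟨(x.1.1 + x.2.1, x.2.2), (x.1.1, x.2.1)⟩)
    (fun x => ⟨(x.2.1, x.2.2 + x.1.2), (x.2.2, x.1.2)⟩) ?_ ?_ ?_ ?_ (fun _ _ => rfl)
  all_goals
    rintro ⟨⟨a, b⟩, ⟨c, d⟩⟩ h
    simp only [Finset.mem_sigma, Finset.HasAntidiagonal.mem_antidiagonal] at h ⊢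
    obtain ⟨h1, h2⟩ := h
    subst h1
  · subst h2; simp [add_assoc]
  · subst h2; simp [add_assoc]
  · subst h2; rfl
  · subst h2; rfl

/-! ### Operators on a Hilbert space and the vacuum state -/

section

variable {H : Type*} [NormedAddCommGroup H] [InnerProductSpace ℂ H] [CompleteSpace H]

theorem inner_star_apply (T : H →L[ℂ] H) (x y : H) : inner ℂ (star T x) y = inner ℂ x (T y) := by
  rw [ContinuousLinearMap.star_eq_adjoint, ContinuousLinearMap.adjoint_inner_left]

/-- The vector state of `Ω`. -/
noncomputable def vectorState (Ω : H) : (H →L[ℂ] H) →ₗ[ℂ] ℂ where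
  toFun T := inner ℂ Ω (T Ω)
  map_add' S T := by simp
  map_smul' c T := by simp

omit [CompleteSpace H] in
theorem vectorState_apply (Ω : H) (T : H →L[ℂ] H) : vectorState Ω T = inner ℂ Ω (T Ω) := rfl

theorem isState_vectorState {Ω : H} (hΩ : ‖Ω‖ = 1) : IsState (vectorState Ω) := by
  constructor
  · simp [vectorState_apply, inner_self_eq_norm_sq_to_K, hΩ]
  · intro T
    rw [vectorState_apply, mul_apply_eq_comp, ← inner_star_apply, star_star]
    rw [inner_self_eq_norm_sq_to_K]
    exact pow_nonneg (Complex.zero_le_real.2 (norm_nonneg (T Ω))) 2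

omit [CompleteSpace H] in
theorem aeval_apply_eq (l : H →L[ℂ] H) (r : Polynomial ℂ) (w : H) :
    Polynomial.aeval l r w = l (Polynomial.aeval l r.divX w) + r.coeff 0 • w := by
  conv_lhs =>
    rw [← Polynomial.divX_mul_X_add r, mul_comm, map_add, map_mul, Polynomial.aeval_X,
      Polynomial.aeval_C, Algebra.algebraMap_eq_smul_one]
  rfl

/-- `l` is a creation operator on a Fock space over the Hilbert space on which `a` acts:
the relations `l* a ^ k l = φ(a ^ k)` and `l* a ^ k Ω = 0` hold for the vacuum state `φ`. -/
structure IsCreation (Ω : H) (a l : H →L[ℂ] H) : Prop where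
  norm_vacuum : ‖Ω‖ = 1
  isSelfAdjoint : IsSelfAdjoint a
  star_mul_mul : ∀ k w, star l ((a ^ k) (l w)) = vectorState Ω (a ^ k) • w
  star_vacuum : ∀ k, star l ((a ^ k) Ω) = 0

namespace IsCreation

variable {Ω : H} {a l : H →L[ℂ] H} (h : IsCreation Ω a l)

include h

/-- The case `k = 0` of the defining relation, since `φ(1) = 1`. -/
theorem star_apply (w : H) : star l (l w) = w := by
  have := h.star_mul_mul 0 w
  rwa [pow_zero, (isState_vectorState h.norm_vacuum).1, one_smul] at this

theorem star_apply_vacuum : star l Ω = 0 := by simpa using h.star_vacuum 0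

theorem inner_vacuum_apply (w : H) : inner ℂ Ω (l w) = 0 := by
  rw [← inner_star_apply, h.star_apply_vacuum, inner_zero_left]

theorem inner_vacuum_pow_apply (k : ℕ) (w : H) : inner ℂ Ω ((a ^ k) (l w)) = 0 := by
  rw [← inner_star_apply, (h.isSelfAdjoint.pow k).star_eq, ← inner_star_apply, h.star_vacuum,
    inner_zero_left]

/-- With `a` replaced by `0`, the perturbation is the semicircular element itself, so its moments
are a special case of the recursion for perturbed elements. -/
theorem zero : IsCreation Ω 0 l where
  norm_vacuum := h.norm_vacuum
  isSelfAdjoint := .zero _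
  star_mul_mul k w := by
    rcases k with _ | k
    · rw [pow_zero, (isState_vectorState h.norm_vacuum).1, one_smul]
      exact h.star_apply w
    · simp
  star_vacuum k := by
    rcases k with _ | k
    · exact h.star_apply_vacuum
    · simp

/-! #### Freeness -/

/-- On the kernel of `l*` the relation `l* l = 1` makes `l*` lower the degree of a polynomial in `l`
and kill its constant term. Hence no `l*` survives in `T w`. -/
theorem exists_polynomial (σ : ℂ) {T : H →L[ℂ] H}
    (hT : T ∈ Algebra.adjoin ℂ {σ • (l + star l)}) :
    ∃ r : Polynomial ℂ, ∀ w, star l w = 0 → T w = Polynomial.aeval l r w := by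
  have hdiv : ∀ (r : Polynomial ℂ) (w : H), star l w = 0 →
      star l (Polynomial.aeval l r w) = Polynomial.aeval l r.divX w := by
    intro r w hw
    rw [aeval_apply_eq]
    simp [-pow_apply_eq_iterate, -FunLike.coe_pow_eq_iterate, h.star_apply, hw]
  have hpow : ∀ n, ∃ r : Polynomial ℂ, ∀ w, star l w = 0 →
      ((σ • (l + star l)) ^ n) w = Polynomial.aeval l r w := by
    intro n
    induction n with
    | zero => exact ⟨1, fun w _ => by simp [-pow_apply_eq_iterate, -FunLike.coe_pow_eq_iterate]⟩
    | succ n ih =>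
      obtain ⟨r, hr⟩ := ih
      refine ⟨Polynomial.C σ * (Polynomial.X * r + r.divX), fun w hw => ?_⟩
      rw [pow_succ', mul_apply_eq_comp, hr w hw]
      simp [-pow_apply_eq_iterate, -FunLike.coe_pow_eq_iterate, hdiv r w hw,
        Algebra.algebraMap_eq_smul_one]
  rw [Algebra.adjoin_singleton_eq_range_aeval] at hT
  obtain ⟨p, rfl⟩ := hT
  choose r hr using hpow
  refine ⟨∑ k ∈ Finset.range (p.natDegree + 1), Polynomial.C (p.coeff k) * r k, fun w hw => ?_⟩
  change Polynomial.aeval (σ • (l + star l)) p w = _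
  rw [Polynomial.aeval_eq_sum_range]
  simp [-pow_apply_eq_iterate, -FunLike.coe_pow_eq_iterate, -smul_add, hr _ w hw,
    Algebra.algebraMap_eq_smul_one]

/-- The constant term of the polynomial in `l` is `φ(T)`, as seen at `w = Ω`, because `Ω` is
orthogonal to the range of `l`. -/
theorem apply_of_mem_adjoin_add (σ : ℂ) {T : H →L[ℂ] H}
    (hT : T ∈ Algebra.adjoin ℂ {σ • (l + star l)}) :
    ∀ w, star l w = 0 → ∃ w', T w = vectorState Ω T • w + l w' := by
  obtain ⟨r, hr⟩ := h.exists_polynomial σ hT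
  have key : ∀ w, star l w = 0 → T w = r.coeff 0 • w + l (Polynomial.aeval l r.divX w) := by
    intro w hw
    rw [hr w hw, aeval_apply_eq, add_comm]
  have h0 : vectorState Ω T = r.coeff 0 := by
    rw [vectorState_apply, key Ω h.star_apply_vacuum, inner_add_right, h.inner_vacuum_apply,
      inner_smul_right, inner_self_eq_norm_sq_to_K, h.norm_vacuum]
    simp
  exact fun w hw => ⟨_, h0 ▸ key w hw⟩

theorem mem_adjoin_relations {T : H →L[ℂ] H} (hT : T ∈ Algebra.adjoin ℂ {a}) :
    (∀ w, star l (T (l w)) = vectorState Ω T • w) ∧ star l (T Ω) = 0 ∧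
      ∀ w, inner ℂ Ω (T (l w)) = 0 := by
  rw [Algebra.adjoin_singleton_eq_range_aeval] at hT
  obtain ⟨p, rfl⟩ := hT
  change (∀ w, star l (Polynomial.aeval a p (l w)) = vectorState Ω (Polynomial.aeval a p) • w) ∧
    star l (Polynomial.aeval a p Ω) = 0 ∧ ∀ w, inner ℂ Ω (Polynomial.aeval a p (l w)) = 0
  rw [Polynomial.aeval_eq_sum_range]
  refine ⟨fun w => ?_, ?_, fun w => ?_⟩
  · simp [-pow_apply_eq_iterate, -FunLike.coe_pow_eq_iterate, h.star_mul_mul,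
      Finset.sum_smul, smul_smul]
  · simp [-pow_apply_eq_iterate, -FunLike.coe_pow_eq_iterate, h.star_vacuum]
  · simp [-pow_apply_eq_iterate, -FunLike.coe_pow_eq_iterate, h.inner_vacuum_pow_apply]

/-- Two kinds of vectors alternate. Centred elements of the algebra of `a` send `Ω` and the range of
`l` into the kernel of `l*`, orthogonally to `Ω`. Centred elements of the other algebra send that
kernel into the range of `l`. Either way an alternating product maps `Ω` to a vector orthogonal to
`Ω`. -/
theorem freelyIndependent (σ : ℂ) : FreelyIndependent (vectorState Ω)
    ![Algebra.adjoin ℂ {a}, Algebra.adjoin ℂ {σ • (l + star l)}] := by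
  let I : Fin 2 → H → Prop := ![fun v => star l v = 0 ∧ inner ℂ Ω v = 0, fun v => ∃ w, v = l w]
  have step : ∀ (j j' : Fin 2) (T : H →L[ℂ] H) (v : H), j ≠ j' →
      T ∈ ![Algebra.adjoin ℂ {a}, Algebra.adjoin ℂ {σ • (l + star l)}] j →
      vectorState Ω T = 0 → (v = Ω ∨ I j' v) → I j (T v) := by
    intro j j' T v hj hT hT0 hv
    fin_cases j <;> fin_cases j'
    · exact absurd rfl hj
    · obtain ⟨h1, h2, h3⟩ := h.mem_adjoin_relations (T := T) hT
      rcases hv with rfl | ⟨w, rfl⟩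
      · exact ⟨h2, hT0⟩
      · refine ⟨?_, h3 w⟩
        rw [h1, hT0, zero_smul]
    · have hv' : star l v = 0 := by
        rcases hv with rfl | hv
        exacts [h.star_apply_vacuum, hv.1]
      obtain ⟨w', hw'⟩ := h.apply_of_mem_adjoin_add σ (T := T) hT v hv'
      exact ⟨w', by rw [hw', hT0, zero_smul, zero_add]⟩
    · exact absurd rfl hj
  have key : ∀ (n : ℕ) (i : Fin (n + 1) → Fin 2) (x : Fin (n + 1) → (H →L[ℂ] H)),
      (∀ k : Fin n, i k.castSucc ≠ i k.succ) →
      (∀ k, x k ∈ ![Algebra.adjoin ℂ {a}, Algebra.adjoin ℂ {σ • (l + star l)}] (i k)) →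
      (∀ k, vectorState Ω (x k) = 0) → I (i 0) ((List.ofFn x).prod Ω) := by
    intro n
    induction n with
    | zero =>
      intro i x _ hx hx0
      simp only [List.ofFn_succ, List.ofFn_zero, List.prod_cons, List.prod_nil, mul_one]
      -- In `Fin 2`, `i 0 + 1` is the other index; it plays no role when the vector is `Ω`.
      refine step (i 0) (i 0 + 1) (x 0) Ω ?_ (hx 0) (hx0 0) (.inl rfl)
      generalize i 0 = j
      revert j
      decide
    | succ n ih =>
      intro i x hi hx hx0
      rw [List.ofFn_succ, List.prod_cons, mul_apply_eq_comp]
      exact step (i 0) (i 1) (x 0) _ (hi 0) (hx 0) (hx0 0) (.inr (ih (fun k => i k.succ)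
        (fun k => x k.succ) (fun k => hi k.succ) (fun k => hx k.succ) (fun k => hx0 k.succ)))
  intro n i x hi hx hx0
  have hI := key n i x hi hx hx0
  rw [vectorState_apply]
  revert hI
  generalize i 0 = j
  fin_cases j
  · exact fun hI => hI.2
  · rintro ⟨w, hw⟩
    rw [hw, h.inner_vacuum_apply]

/-! #### Moments of a semicircular perturbation -/

/-- Expanding the leftmost factor leaves no term with `l`, since `a ^ k l w` is orthogonal to `Ω`.
-/
theorem vectorState_pow_succ (σ : ℂ) (n k : ℕ) :
    vectorState Ω (a ^ k * (a + σ • (l + star l)) ^ (n + 1)) =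
      vectorState Ω (a ^ (k + 1) * (a + σ • (l + star l)) ^ n) +
      σ * inner ℂ Ω ((a ^ k) (star l (((a + σ • (l + star l)) ^ n) Ω))) := by
  rw [pow_succ' (a + _), pow_succ a]
  simp [-pow_apply_eq_iterate, -FunLike.coe_pow_eq_iterate, vectorState_apply,
    h.inner_vacuum_pow_apply]

/-- The formula for `l*` is a hypothesis here so that lower orders can be used inside the induction
that proves it. -/
theorem vectorState_pow_add_two (σ : ℂ) (n k : ℕ)
    (hn : star l (((a + σ • (l + star l)) ^ (n + 1)) Ω) =
      σ • ∑ p ∈ Finset.HasAntidiagonal.antidiagonal n,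
        vectorState Ω (a ^ 0 * (a + σ • (l + star l)) ^ p.1) •
          ((a + σ • (l + star l)) ^ p.2) Ω) :
    vectorState Ω (a ^ k * (a + σ • (l + star l)) ^ (n + 2)) =
      vectorState Ω (a ^ (k + 1) * (a + σ • (l + star l)) ^ (n + 1)) +
      σ ^ 2 * ∑ p ∈ Finset.HasAntidiagonal.antidiagonal n,
        vectorState Ω (a ^ 0 * (a + σ • (l + star l)) ^ p.1) *
          vectorState Ω (a ^ k * (a + σ • (l + star l)) ^ p.2) := by
  rw [h.vectorState_pow_succ σ (n + 1) k, hn, map_smul, map_sum, inner_smul_right, inner_sum,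
    ← mul_assoc, ← sq]
  simp only [map_smul, inner_smul_right]
  rfl

/-- Heuristically, the leading `l*` is annihilated by the `l` of one of the factors: what stands
between them contributes its vacuum expectation, and the factors to the right remain. The index `k`
is needed in the induction because expanding the leftmost factor may produce one more `a`. -/
theorem star_pow_apply (σ : ℂ) (n : ℕ) : ∀ k,
    star l ((a ^ k) (((a + σ • (l + star l)) ^ (n + 1)) Ω)) =
      σ • ∑ p ∈ Finset.HasAntidiagonal.antidiagonal n,
        vectorState Ω (a ^ k * (a + σ • (l + star l)) ^ p.1) •
          ((a + σ • (l + star l)) ^ p.2) Ω := by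
  set X := a + σ • (l + star l) with hX
  have expand : ∀ n k, star l ((a ^ k) ((X ^ (n + 1)) Ω)) =
      star l ((a ^ (k + 1)) ((X ^ n) Ω)) + σ • (vectorState Ω (a ^ k) • (X ^ n) Ω) +
        σ • star l ((a ^ k) (star l ((X ^ n) Ω))) := by
    intro n k
    rw [pow_succ' X, pow_succ a, mul_apply_eq_comp, mul_apply_eq_comp,
      ← h.star_mul_mul]
    have hXv : ∀ v, X v = a v + σ • (l v + star l v) := fun _ => rfl
    rw [hXv]
    simp [-pow_apply_eq_iterate, -FunLike.coe_pow_eq_iterate, add_assoc]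
  induction n using Nat.strong_induction_on with
  | _ n ih =>
    intro k
    rw [expand]
    rcases n with _ | n
    · simp [-pow_apply_eq_iterate, -FunLike.coe_pow_eq_iterate, h.star_vacuum, h.star_apply_vacuum]
    · have e0 : star l ((X ^ (n + 1)) Ω) = σ • ∑ p ∈ Finset.HasAntidiagonal.antidiagonal n,
          vectorState Ω (X ^ p.1) • (X ^ p.2) Ω := by
        simpa only [pow_zero, one_apply_eq_self, one_mul] using ih n (Nat.lt_succ_self n) 0
      rw [ih n (Nat.lt_succ_self n) (k + 1), e0, Finset.Nat.sum_antidiagonal_succ]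
      simp only [pow_zero, mul_one, map_smul, map_sum, smul_add]
      rw [add_assoc, add_left_comm]
      congr 1
      have h1 := h.vectorState_pow_succ σ 0 k
      simp only [← hX, zero_add, pow_one, pow_zero, mul_one, one_apply_eq_self,
        h.star_apply_vacuum, map_zero, inner_zero_right, mul_zero, add_zero] at h1
      rcases n with _ | n
      · simp [-pow_apply_eq_iterate, -FunLike.coe_pow_eq_iterate, h.star_vacuum, h1]
      -- The coefficients wanted at the next order split, by the moment recursion, into those of the
      -- `a`-term and a double sum; the `l* a ^ k l*` term, treated twice by induction, supplies
      -- that double sum.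
      · have hF : ∀ p ∈ Finset.HasAntidiagonal.antidiagonal n,
            vectorState Ω (a ^ k * X ^ (p.1 + (1 + 1))) =
              vectorState Ω (a ^ (k + 1) * X ^ (p.1 + 1)) +
              σ ^ 2 * ∑ r ∈ Finset.HasAntidiagonal.antidiagonal p.1,
                vectorState Ω (a ^ 0 * X ^ r.1) * vectorState Ω (a ^ k * X ^ r.2) := fun p hp =>
          h.vectorState_pow_add_two σ p.1 k (by
            have := ih p.1 (by
              have := Finset.HasAntidiagonal.mem_antidiagonal.1 hp
              omega) 0
            rwa [pow_zero, one_apply_eq_self, ← pow_zero a] at this)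
        rw [Finset.Nat.sum_antidiagonal_succ, Finset.Nat.sum_antidiagonal_succ
            (f := fun p => vectorState Ω (a ^ k * X ^ (p.1 + 1)) • (X ^ p.2) Ω),
          Finset.Nat.sum_antidiagonal_succ']
        simp only [zero_add, pow_one, pow_zero, mul_one, one_apply_eq_self,
          h.star_vacuum, smul_zero, h1, smul_add, add_assoc]
        congr 1
        rw [← smul_add]
        congr 1
        have e1 : ∀ p ∈ Finset.HasAntidiagonal.antidiagonal n,
            vectorState Ω (X ^ p.1) • star l ((a ^ k) ((X ^ (p.2 + 1)) Ω)) =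
              ∑ r ∈ Finset.HasAntidiagonal.antidiagonal p.2,
                (σ * (vectorState Ω (X ^ p.1) * vectorState Ω (a ^ k * X ^ r.1))) •
                  (X ^ r.2) Ω := by
          intro p hp
          rw [ih p.2 (by
              have := Finset.HasAntidiagonal.mem_antidiagonal.1 hp
              omega) k, Finset.smul_sum, Finset.smul_sum]
          refine Finset.sum_congr rfl fun r _ => ?_
          rw [smul_smul, smul_smul]
          congr 1
          ring
        rw [Finset.sum_congr rfl e1, sum_antidiagonal_antidiagonal (fun i j m =>
          (σ * (vectorState Ω (X ^ i) * vectorState Ω (a ^ k * X ^ j))) • (X ^ m) Ω),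
          Finset.smul_sum, ← Finset.sum_add_distrib]
        refine Finset.sum_congr rfl fun p hp => ?_
        rw [hF p hp, add_smul]
        congr 1
        rw [Finset.smul_sum, Finset.mul_sum, Finset.sum_smul]
        refine Finset.sum_congr rfl fun r _ => ?_
        rw [smul_smul, pow_zero, one_mul]
        congr 1
        ring

/-- The mixed moments of `a` and a semicircular perturbation of `a`. -/
theorem vectorState_pow_recursion (σ : ℂ) (n k : ℕ) :
    vectorState Ω (a ^ k * (a + σ • (l + star l)) ^ (n + 2)) =
      vectorState Ω (a ^ (k + 1) * (a + σ • (l + star l)) ^ (n + 1)) +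
      σ ^ 2 * ∑ p ∈ Finset.HasAntidiagonal.antidiagonal n,
        vectorState Ω (a ^ 0 * (a + σ • (l + star l)) ^ p.1) *
          vectorState Ω (a ^ k * (a + σ • (l + star l)) ^ p.2) := by
  refine h.vectorState_pow_add_two σ n k ?_
  have := h.star_pow_apply σ n 0
  rwa [pow_zero, one_apply_eq_self, ← pow_zero a] at this

theorem vectorState_pow_one (σ : ℂ) (k : ℕ) :
    vectorState Ω (a ^ k * (a + σ • (l + star l)) ^ 1) =
      vectorState Ω (a ^ (k + 1) * (a + σ • (l + star l)) ^ 0) := by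
  have := h.vectorState_pow_succ σ 0 k
  simpa [h.star_apply_vacuum] using this

theorem semicircular_pow_one (σ : ℂ) : vectorState Ω ((σ • (l + star l)) ^ 1) = 0 := by
  simpa using h.zero.vectorState_pow_one σ 0

theorem semicircular_pow_add_two (σ : ℂ) (n : ℕ) :
    vectorState Ω ((σ • (l + star l)) ^ (n + 2)) =
      σ ^ 2 * ∑ p ∈ Finset.HasAntidiagonal.antidiagonal n,
        vectorState Ω ((σ • (l + star l)) ^ p.1) * vectorState Ω ((σ • (l + star l)) ^ p.2) := by
  simpa using h.zero.vectorState_pow_recursion σ n 0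

end IsCreation

end

/-! ### Free independence determines the joint moments -/

/-- Products of elements of `F` with the property `c`, neighbouring factors of which come from
different algebras generated by the free generators. The first factor belongs to the generator
`i`. -/
inductive IsAlternating (c : FreeAlgebra ℂ (Fin 2) → Prop) : Fin 2 → FreeAlgebra ℂ (Fin 2) → Prop
  | single {i : Fin 2} {p : FreeAlgebra ℂ (Fin 2)}
      (hp : p ∈ Algebra.adjoin ℂ {FreeAlgebra.ι ℂ i}) (hc : c p) : IsAlternating c i p
  | cons {i j : Fin 2} {p w : FreeAlgebra ℂ (Fin 2)}
      (hp : p ∈ Algebra.adjoin ℂ {FreeAlgebra.ι ℂ i}) (hc : c p) (hij : i ≠ j)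
      (hw : IsAlternating c j w) : IsAlternating c i (p * w)

/-- The alternating products of centred elements and the scalars span the free algebra. -/
theorem span_isAlternating_eq_top (τ : FreeAlgebra ℂ (Fin 2) →ₗ[ℂ] ℂ) (hτ : τ 1 = 1) :
    Submodule.span ℂ ({1} ∪ {w | ∃ i, IsAlternating (fun p => τ p = 0) i w}) = ⊤ := by
  set N := Submodule.span ℂ
    ({1} ∪ {w : FreeAlgebra ℂ (Fin 2) | ∃ i, IsAlternating (fun p => τ p = 0) i w}) with hN
  have h1 : (1 : FreeAlgebra ℂ (Fin 2)) ∈ N := Submodule.subset_span (.inl rfl)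
  have hmem : ∀ i w, IsAlternating (fun p => τ p = 0) i w → w ∈ N := fun i w hw =>
    Submodule.subset_span (.inr ⟨i, hw⟩)
  have hcent : ∀ (i : Fin 2) (p : FreeAlgebra ℂ (Fin 2)),
      p ∈ Algebra.adjoin ℂ {FreeAlgebra.ι ℂ i} →
        p - τ p • 1 ∈ Algebra.adjoin ℂ {FreeAlgebra.ι ℂ i} ∧ τ (p - τ p • 1) = 0 := by
    intro i p hp
    refine ⟨sub_mem hp (Subalgebra.smul_mem _ (one_mem _) _), ?_⟩
    rw [map_sub, map_smul, hτ, smul_eq_mul, mul_one, sub_self]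
  have hgen : ∀ j : Fin 2, FreeAlgebra.ι ℂ j ∈ Algebra.adjoin ℂ {FreeAlgebra.ι ℂ j} := fun j =>
    Algebra.subset_adjoin rfl
  have hleft : ∀ (j : Fin 2) (w : FreeAlgebra ℂ (Fin 2)), w ∈ N → FreeAlgebra.ι ℂ j * w ∈ N := by
    intro j w hw
    induction hw using Submodule.span_induction with
    | zero => simp
    | add x y _ _ hx hy => rw [mul_add]; exact add_mem hx hy
    | smul c x _ hx => rw [mul_smul_comm]; exact Submodule.smul_mem _ _ hx
    | mem w hw =>
      -- Centring the first factor. A generator either joins the product as a new factor or merges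
      -- with the first factor of its own algebra; the scalar part leaves a shorter alternating
      -- product or a scalar.
      have hdec : ∀ p v : FreeAlgebra ℂ (Fin 2), p * v = (p - τ p • 1) * v + τ p • v := by
        intro p v
        rw [sub_mul, smul_mul_assoc, one_mul, sub_add_cancel]
      have hX := hcent j _ (hgen j)
      rcases hw with rfl | ⟨i, hw⟩
      · rw [hdec, mul_one]
        exact add_mem (hmem j _ (.single hX.1 hX.2)) (Submodule.smul_mem _ _ h1)
      · by_cases hij : j = i
        · subst hij
          cases hw with
          | single hp hc =>
            have hp' := hcent j _ (mul_mem (hgen j) hp)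
            rw [← sub_add_cancel (FreeAlgebra.ι ℂ j * w) (τ (FreeAlgebra.ι ℂ j * w) • 1)]
            exact add_mem (hmem j _ (.single hp'.1 hp'.2)) (Submodule.smul_mem _ _ h1)
          | @cons _ k p v hp hc hjk hv =>
            have hp' := hcent j _ (mul_mem (hgen j) hp)
            rw [← mul_assoc, hdec]
            exact add_mem (hmem j _ (.cons hp'.1 hp'.2 hjk hv))
              (Submodule.smul_mem _ _ (hmem k _ hv))
        · rw [hdec]
          exact add_mem (hmem j _ (.cons hX.1 hX.2 hij hw)) (Submodule.smul_mem _ _ (hmem i _ hw))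
  have hall : ∀ z w : FreeAlgebra ℂ (Fin 2), w ∈ N → z * w ∈ N := by
    intro z
    induction z using FreeAlgebra.induction with
    | grade0 r => intro w hw; rw [← Algebra.smul_def]; exact Submodule.smul_mem _ _ hw
    | grade1 x => exact hleft x
    | mul a b ha hb => intro w hw; rw [mul_assoc]; exact ha _ (hb _ hw)
    | add a b ha hb => intro w hw; rw [add_mul]; exact add_mem (ha _ hw) (hb _ hw)
  refine Submodule.eq_top_iff'.2 fun z => ?_
  simpa using hall z 1 h1

section

variable {A : Type*} [CStarAlgebra A] {φ : A →ₗ[ℂ] ℂ} {a b : A}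

theorem lift_mem_adjoin (a b : A) {i : Fin 2} {p : FreeAlgebra ℂ (Fin 2)}
    (hp : p ∈ Algebra.adjoin ℂ {FreeAlgebra.ι ℂ i}) : FreeAlgebra.lift ℂ ![a, b] p ∈
      (![Algebra.adjoin ℂ {a}, Algebra.adjoin ℂ {b}] : Fin 2 → Subalgebra ℂ A) i := by
  have h : FreeAlgebra.lift ℂ ![a, b] p ∈
      (Algebra.adjoin ℂ {FreeAlgebra.ι ℂ i}).map (FreeAlgebra.lift ℂ ![a, b]) := ⟨p, hp, rfl⟩
  rw [AlgHom.map_adjoin, Set.image_singleton, FreeAlgebra.lift_ι_apply] at h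
  fin_cases i <;> exact h

theorem IsAlternating.exists_list {c : FreeAlgebra ℂ (Fin 2) → Prop} {i : Fin 2}
    {w : FreeAlgebra ℂ (Fin 2)} (hw : IsAlternating c i w) :
    ∃ (n : ℕ) (k : Fin (n + 1) → Fin 2) (x : Fin (n + 1) → FreeAlgebra ℂ (Fin 2)),
      k 0 = i ∧ (∀ m : Fin n, k m.castSucc ≠ k m.succ) ∧
      (∀ m, x m ∈ Algebra.adjoin ℂ {FreeAlgebra.ι ℂ (k m)}) ∧ (∀ m, c (x m)) ∧
      w = (List.ofFn x).prod := by
  induction hw with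
  | @single i p hp hc =>
    exact ⟨0, fun _ => i, fun _ => p, rfl, fun m => m.elim0, fun _ => hp, fun _ => hc, by simp⟩
  | @cons i j p w hp hc hij _ ih =>
    obtain ⟨n, k, x, hk0, hk, hx, hxc, rfl⟩ := ih
    refine ⟨n + 1, Fin.cons i k, Fin.cons p x, rfl, ?_, ?_, ?_, ?_⟩
    · intro m
      refine Fin.cases ?_ (fun m => ?_) m
      · simpa [hk0] using hij
      · simpa [← Fin.succ_castSucc] using hk m
    · intro m
      refine Fin.cases ?_ (fun m => ?_) m
      · simpa using hp
      · simpa using hx m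
    · intro m
      refine Fin.cases ?_ (fun m => ?_) m
      · simpa using hc
      · simpa using hxc m
    · simp [List.ofFn_succ]

theorem FreelyIndependent.apply_lift_eq_zero
    (h : FreelyIndependent φ ![Algebra.adjoin ℂ {a}, Algebra.adjoin ℂ {b}]) {i : Fin 2}
    {w : FreeAlgebra ℂ (Fin 2)}
    (hw : IsAlternating (fun p => φ (FreeAlgebra.lift ℂ ![a, b] p) = 0) i w) :
    φ (FreeAlgebra.lift ℂ ![a, b] w) = 0 := by
  obtain ⟨n, k, x, -, hk, hx, hc, rfl⟩ := hw.exists_list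
  rw [map_list_prod, List.map_ofFn]
  exact h n k _ hk (fun m => lift_mem_adjoin a b (hx m)) hc

theorem IsAlternating.mono {c c' : FreeAlgebra ℂ (Fin 2) → Prop} {i : Fin 2}
    {w : FreeAlgebra ℂ (Fin 2)} (hw : IsAlternating c i w)
    (hcc : ∀ i, ∀ p ∈ Algebra.adjoin ℂ {FreeAlgebra.ι ℂ i}, c p → c' p) :
    IsAlternating c' i w := by
  induction hw with
  | single hp hc => exact .single hp (hcc _ _ hp hc)
  | cons hp hc hij _ ih => exact .cons hp (hcc _ _ hp hc) hij ih

end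

/-- The moments of the sum of two freely independent elements depend only on the moments of
these elements. -/
theorem FreelyIndependent.moments_add_eq {A B : Type*} [CStarAlgebra A] [CStarAlgebra B]
    {φ : A →ₗ[ℂ] ℂ} {ψ : B →ₗ[ℂ] ℂ} {a b : A} {a' b' : B} (hφ : φ 1 = 1) (hψ : ψ 1 = 1)
    (h : FreelyIndependent φ ![Algebra.adjoin ℂ {a}, Algebra.adjoin ℂ {b}])
    (h' : FreelyIndependent ψ ![Algebra.adjoin ℂ {a'}, Algebra.adjoin ℂ {b'}])
    (ha : ∀ n : ℕ, φ (a ^ n) = ψ (a' ^ n)) (hb : ∀ n : ℕ, φ (b ^ n) = ψ (b' ^ n)) (n : ℕ) :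
    φ ((a + b) ^ n) = ψ ((a' + b') ^ n) := by
  -- Both states are pulled back to one free algebra. They agree on the algebra of each generator,
  -- hence have the same centred elements there, and both vanish on alternating products of these.
  -- Such products and `1` span.
  let f := FreeAlgebra.lift ℂ ![a, b]
  let g := FreeAlgebra.lift ℂ ![a', b']
  let τ : FreeAlgebra ℂ (Fin 2) →ₗ[ℂ] ℂ := φ ∘ₗ f.toLinearMap
  let ρ : FreeAlgebra ℂ (Fin 2) →ₗ[ℂ] ℂ := ψ ∘ₗ g.toLinearMap
  have hτ : τ 1 = 1 := by simp [τ, hφ]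
  have hρ : ρ 1 = 1 := by simp [ρ, hψ]
  have hpow : ∀ (i : Fin 2) (n : ℕ), τ (FreeAlgebra.ι ℂ i ^ n) = ρ (FreeAlgebra.ι ℂ i ^ n) := by
    intro i n
    fin_cases i
    · simpa [τ, ρ, f, g] using ha n
    · simpa [τ, ρ, f, g] using hb n
  have hadj : ∀ i, ∀ p ∈ Algebra.adjoin ℂ {FreeAlgebra.ι ℂ i}, τ p = ρ p := by
    intro i p hp
    rw [Algebra.adjoin_singleton_eq_range_aeval] at hp
    obtain ⟨r, rfl⟩ := hp
    change τ (Polynomial.aeval _ r) = ρ (Polynomial.aeval _ r)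
    rw [Polynomial.aeval_eq_sum_range]
    simp only [map_sum, map_smul, hpow]
  have heq : τ = ρ := by
    refine LinearMap.ext_on (span_isAlternating_eq_top τ hτ) ?_
    rintro w (rfl | ⟨i, hw⟩)
    · rw [hτ, hρ]
    · have h1 : τ w = 0 := h.apply_lift_eq_zero hw
      have h2 : ρ w = 0 := h'.apply_lift_eq_zero
        (hw.mono fun i p hp hc => ((hadj i p hp).symm.trans hc :))
      rw [h1, h2]
  have := LinearMap.congr_fun heq ((FreeAlgebra.ι ℂ 0 + FreeAlgebra.ι ℂ 1) ^ n)
  simpa [τ, ρ, f, g] using this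

/-! ### The moments of the semicircular distribution -/

/-- The `n`-th moment of the standard semicircular distribution. -/
def semicircleMoment (n : ℕ) : ℕ := if Even n then catalan (n / 2) else 0

theorem semicircleMoment_add_two (n : ℕ) : semicircleMoment (n + 2) =
    ∑ p ∈ Finset.HasAntidiagonal.antidiagonal n, semicircleMoment p.1 * semicircleMoment p.2 := by
  rcases Nat.even_or_odd' n with ⟨k, rfl | rfl⟩
  · have h1 : semicircleMoment (2 * k + 2) = catalan (k + 1) := by
      rw [semicircleMoment, if_pos (by simp [parity_simps])]
      congr 1
      omega
    have h2 : (Finset.HasAntidiagonal.antidiagonal k).image (fun p => (2 * p.1, 2 * p.2)) ⊆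
        Finset.HasAntidiagonal.antidiagonal (2 * k) := by
      intro p hp
      obtain ⟨q, hq, rfl⟩ := Finset.mem_image.1 hp
      rw [Finset.HasAntidiagonal.mem_antidiagonal] at hq ⊢
      simp only
      omega
    rw [h1, catalan_succ', ← Finset.sum_subset h2, Finset.sum_image]
    · refine Finset.sum_congr rfl fun p _ => ?_
      simp [semicircleMoment]
    · intro p _ q _ h
      simp only [Prod.mk.injEq] at h
      exact Prod.ext (by omega) (by omega)
    · intro p hp hp'
      rw [Finset.HasAntidiagonal.mem_antidiagonal] at hp
      by_cases h : Even p.1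
      · refine absurd (Finset.mem_image.2 ⟨(p.1 / 2, p.2 / 2), ?_, ?_⟩) hp'
        · rw [Finset.HasAntidiagonal.mem_antidiagonal]
          simp only
          obtain ⟨i, hi⟩ := h
          omega
        · obtain ⟨i, hi⟩ := h
          exact Prod.ext (by simp only; omega) (by simp only; omega)
      · rw [semicircleMoment, if_neg h, zero_mul]
  · rw [semicircleMoment, if_neg (by simp [parity_simps]), Finset.sum_eq_zero]
    intro p hp
    rw [Finset.HasAntidiagonal.mem_antidiagonal] at hp
    by_cases h : Even p.1
    · have : ¬ Even p.2 := by
        obtain ⟨i, hi⟩ := h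
        rw [Nat.not_even_iff_odd]
        exact ⟨k - i, by omega⟩
      rw [semicircleMoment, semicircleMoment, if_neg this, mul_zero]
    · rw [semicircleMoment, if_neg h, zero_mul]

/-- Used twice: for one-coloured diagrams with `s = 1`, and for the vacuum moments of `σ(l + l*)`.
-/
theorem eq_semicircleMoment_of_recursion {R : Type*} [CommSemiring R] {f : ℕ → R} (s : R)
    (h0 : f 0 = 1) (h1 : f 1 = 0) (h2 : ∀ n, f (n + 2) =
      s ^ 2 * ∑ p ∈ Finset.HasAntidiagonal.antidiagonal n, f p.1 * f p.2) (n : ℕ) :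
    f n = s ^ n * semicircleMoment n := by
  induction n using Nat.strong_induction_on with
  | _ n ih =>
    match n with
    | 0 => simp [h0, semicircleMoment]
    | 1 => simp [h1, semicircleMoment]
    | n + 2 =>
      rw [h2, semicircleMoment_add_two, pow_add, mul_comm (s ^ n), mul_assoc]
      congr 1
      rw [Nat.cast_sum, Finset.mul_sum]
      refine Finset.sum_congr rfl fun p hp => ?_
      rw [Finset.HasAntidiagonal.mem_antidiagonal] at hp
      rw [ih p.1 (by omega), ih p.2 (by omega), ← hp]
      push_cast
      ring

theorem diagramCount_singleton (c : Bool) (n : ℕ) :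
    diagramCount {c} n = semicircleMoment n := by
  have := eq_semicircleMoment_of_recursion (f := diagramCount {c}) 1 (diagramCount_zero _)
    (diagramCount_singleton_one c) (fun n => by
      rw [diagramCount_singleton_add_two, one_pow, one_mul]) n
  simpa using this

/-- The `n`-th moment of the sum of two classically independent standard semicircular random
variables. -/
def twoSemicircleMoment (n : ℕ) : ℕ :=
  ∑ k ∈ Finset.range (n + 1), n.choose k * (semicircleMoment k * semicircleMoment (n - k))

theorem diagramCount_univ_eq (n : ℕ) :
    diagramCount Finset.univ n = twoSemicircleMoment n := by
  rw [diagramCount_univ, twoSemicircleMoment]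
  simp_rw [diagramCount_singleton]

section

variable {H : Type*} [NormedAddCommGroup H] [InnerProductSpace ℂ H] [CompleteSpace H]

theorem IsCreation.vectorState_semicircular_pow {Ω : H} {a l : H →L[ℂ] H} (h : IsCreation Ω a l)
    (σ : ℂ) (n : ℕ) :
    vectorState Ω ((σ • (l + star l)) ^ n) = σ ^ n * semicircleMoment n :=
  eq_semicircleMoment_of_recursion (f := fun n => vectorState Ω ((σ • (l + star l)) ^ n)) σ
    (by rw [pow_zero]; exact (isState_vectorState h.norm_vacuum).1) (h.semicircular_pow_one σ)
    (h.semicircular_pow_add_two σ) n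

/-! ### Two commuting shifts and a creation operator -/

theorem isCreation_zero {Ω : H} {v : H →L[ℂ] H} (hΩ : ‖Ω‖ = 1) (hv : star v * v = 1)
    (hvΩ : star v Ω = 0) : IsCreation Ω 0 v where
  norm_vacuum := hΩ
  isSelfAdjoint := .zero _
  star_mul_mul k w := by
    rcases k with _ | k
    · rw [pow_zero, (isState_vectorState hΩ).1, one_smul]
      exact DFunLike.congr_fun hv w
    · simp
  star_vacuum k := by
    rcases k with _ | k
    · exact hvΩ
    · simp

/-- The relations of two commuting shifts `v₁`, `v₂` on the space of a creation operator `l`. -/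
structure ShiftRelations (Ω : H) (v₁ v₂ l : H →L[ℂ] H) : Prop where
  norm_vacuum : ‖Ω‖ = 1
  star_fst_vacuum : star v₁ Ω = 0
  star_snd_vacuum : star v₂ Ω = 0
  star_creation_vacuum : star l Ω = 0
  star_fst_mul_fst : star v₁ * v₁ = 1
  star_snd_mul_snd : star v₂ * v₂ = 1
  star_creation_mul_creation : star l * l = 1
  star_creation_mul_fst : star l * v₁ = 0
  star_creation_mul_snd : star l * v₂ = 0
  commute : Commute v₁ v₂
  commute_star : Commute (star v₁) v₂

namespace ShiftRelations

variable {Ω : H} {v₁ v₂ l : H →L[ℂ] H} (h : ShiftRelations Ω v₁ v₂ l)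

include h

theorem star_fst_mul_creation : star v₁ * l = 0 := by
  simpa using congrArg star h.star_creation_mul_fst

theorem star_snd_mul_creation : star v₂ * l = 0 := by
  simpa using congrArg star h.star_creation_mul_snd

theorem commute_star' : Commute (star v₂) v₁ := by
  simpa using h.commute_star.star_star.symm

/-- On the common kernel of `v₁*` and `v₂*`, each adjoint commutes past the other shift and either
cancels one factor of its own shift or reaches the vector and gives `0`. Both `Ω` and the range of
`l` lie in this kernel. -/
theorem exists_polynomial (k : ℕ) (t : ℂ) :
    ∃ r ∈ Submodule.span ℂ (Set.range fun p : ℕ × ℕ => v₁ ^ p.1 * v₂ ^ p.2),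
      ∀ w, star v₁ w = 0 → star v₂ w = 0 →
        ((t • (v₁ + star v₁ + (v₂ + star v₂))) ^ k) w = r w := by
  set N := Submodule.span ℂ (Set.range fun p : ℕ × ℕ => v₁ ^ p.1 * v₂ ^ p.2)
  have hm : ∀ i j : ℕ, v₁ ^ i * v₂ ^ j ∈ N := fun i j => Submodule.subset_span ⟨(i, j), rfl⟩
  have h1 : ∀ r ∈ N, v₁ * r ∈ N := by
    intro r hr
    induction hr using Submodule.span_induction with
    | zero => simp
    | add x y _ _ hx hy => rw [mul_add]; exact add_mem hx hy
    | smul c x _ hx => rw [mul_smul_comm]; exact Submodule.smul_mem _ _ hx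
    | mem w hw =>
      obtain ⟨p, rfl⟩ := hw
      simp only
      rw [← mul_assoc, ← pow_succ']
      exact hm _ _
  have h2 : ∀ r ∈ N, v₂ * r ∈ N := by
    intro r hr
    induction hr using Submodule.span_induction with
    | zero => simp
    | add x y _ _ hx hy => rw [mul_add]; exact add_mem hx hy
    | smul c x _ hx => rw [mul_smul_comm]; exact Submodule.smul_mem _ _ hx
    | mem w hw =>
      obtain ⟨p, rfl⟩ := hw
      simp only
      rw [← mul_assoc, ((h.commute.symm).pow_right p.1).eq, mul_assoc, ← pow_succ']
      exact hm _ _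
  have h3 : ∀ r ∈ N, ∃ r' ∈ N, ∀ w, star v₁ w = 0 → star v₂ w = 0 → star v₁ (r w) = r' w := by
    intro r hr
    induction hr using Submodule.span_induction with
    | zero => exact ⟨0, zero_mem _, by simp⟩
    | add x y _ _ hx hy =>
      obtain ⟨x', hx', hx⟩ := hx
      obtain ⟨y', hy', hy⟩ := hy
      exact ⟨x' + y', add_mem hx' hy', fun w h1 h2 => by simp [hx w h1 h2, hy w h1 h2]⟩
    | smul c x _ hx =>
      obtain ⟨x', hx', hx⟩ := hx
      exact ⟨c • x', Submodule.smul_mem _ _ hx', fun w h1 h2 => by simp [hx w h1 h2]⟩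
    | mem w hw =>
      obtain ⟨⟨i, j⟩, rfl⟩ := hw
      rcases i with _ | i
      · refine ⟨0, zero_mem _, fun w hw _ => ?_⟩
        simp only [pow_zero, one_mul]
        rw [← mul_apply_eq_comp, (h.commute_star.pow_right j).eq, mul_apply_eq_comp, hw, map_zero]
        rfl
      · refine ⟨v₁ ^ i * v₂ ^ j, hm i j, fun w _ _ => ?_⟩
        simp only
        rw [← mul_apply_eq_comp, ← mul_assoc, pow_succ', ← mul_assoc, h.star_fst_mul_fst, one_mul]
  have h4 : ∀ r ∈ N, ∃ r' ∈ N, ∀ w, star v₁ w = 0 → star v₂ w = 0 → star v₂ (r w) = r' w := by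
    intro r hr
    induction hr using Submodule.span_induction with
    | zero => exact ⟨0, zero_mem _, by simp⟩
    | add x y _ _ hx hy =>
      obtain ⟨x', hx', hx⟩ := hx
      obtain ⟨y', hy', hy⟩ := hy
      exact ⟨x' + y', add_mem hx' hy', fun w h1 h2 => by simp [hx w h1 h2, hy w h1 h2]⟩
    | smul c x _ hx =>
      obtain ⟨x', hx', hx⟩ := hx
      exact ⟨c • x', Submodule.smul_mem _ _ hx', fun w h1 h2 => by simp [hx w h1 h2]⟩
    | mem w hw =>
      obtain ⟨⟨i, j⟩, rfl⟩ := hw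
      have hc := (h.commute_star'.pow_right i).eq
      rcases j with _ | j
      · refine ⟨0, zero_mem _, fun w _ hw => ?_⟩
        simp only [pow_zero, mul_one]
        rw [← mul_apply_eq_comp, hc, mul_apply_eq_comp, hw, map_zero]
        rfl
      · refine ⟨v₁ ^ i * v₂ ^ j, hm i j, fun w _ _ => ?_⟩
        simp only
        rw [← mul_apply_eq_comp, ← mul_assoc, hc, pow_succ', mul_assoc, ← mul_assoc (star v₂),
          h.star_snd_mul_snd, one_mul]
  induction k with
  | zero => exact ⟨1, by simpa using hm 0 0, fun w _ _ => by simp⟩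
  | succ k ih =>
    obtain ⟨r, hr, hrw⟩ := ih
    obtain ⟨r₁, hr₁, hrw₁⟩ := h3 r hr
    obtain ⟨r₂, hr₂, hrw₂⟩ := h4 r hr
    refine ⟨t • (v₁ * r + r₁ + (v₂ * r + r₂)), Submodule.smul_mem _ _
      (add_mem (add_mem (h1 r hr) hr₁) (add_mem (h2 r hr) hr₂)), fun w hw1 hw2 => ?_⟩
    rw [pow_succ', mul_apply_eq_comp, hrw w hw1 hw2]
    change t • (v₁ (r w) + star v₁ (r w) + (v₂ (r w) + star v₂ (r w))) = _
    rw [hrw₁ w hw1 hw2, hrw₂ w hw1 hw2]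
    rfl

theorem isCreation (t : ℝ) :
    IsCreation Ω ((t : ℂ) • (v₁ + star v₁ + (v₂ + star v₂))) l := by
  -- Only the constant term `c` of `r` matters: `l*` kills the ranges of `v₁` and `v₂`, and `Ω` is
  -- orthogonal to them. So `c = φ(a ^ k)` and `l* a ^ k l = c`.
  have key : ∀ r ∈ Submodule.span ℂ (Set.range fun p : ℕ × ℕ => v₁ ^ p.1 * v₂ ^ p.2),
      ∃ (c : ℂ) (r₁ r₂ : H →L[ℂ] H), r = c • 1 + v₁ * r₁ + v₂ * r₂ := by
    intro r hr
    induction hr using Submodule.span_induction with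
    | zero => exact ⟨0, 0, 0, by simp⟩
    | add x y _ _ hx hy =>
      obtain ⟨c, r₁, r₂, rfl⟩ := hx
      obtain ⟨d, s₁, s₂, rfl⟩ := hy
      refine ⟨c + d, r₁ + s₁, r₂ + s₂, ?_⟩
      rw [add_smul, mul_add, mul_add]
      abel
    | smul d x _ hx =>
      obtain ⟨c, r₁, r₂, rfl⟩ := hx
      exact ⟨d * c, d • r₁, d • r₂, by simp [smul_smul]⟩
    | mem w hw =>
      obtain ⟨⟨i, j⟩, rfl⟩ := hw
      rcases i with _ | i
      · rcases j with _ | j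
        · exact ⟨1, 0, 0, by simp⟩
        · exact ⟨0, 0, v₂ ^ j, by simp [pow_succ']⟩
      · exact ⟨0, v₁ ^ i * v₂ ^ j, 0, by simp [pow_succ', mul_assoc]⟩
  have hl : ∀ T : H →L[ℂ] H, star l * T = 0 → ∀ w, star l (T w) = 0 := fun T hT w =>
    DFunLike.congr_fun hT w
  have hl1 := hl _ h.star_creation_mul_fst
  have hl2 := hl _ h.star_creation_mul_snd
  have hll : ∀ w, star l (l w) = w := fun w => DFunLike.congr_fun h.star_creation_mul_creation w
  refine ⟨h.norm_vacuum, ?_, fun k w => ?_, fun k => ?_⟩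
  · refine IsSelfAdjoint.smul (Complex.conj_ofReal t) ?_
    exact (IsSelfAdjoint.add_star_self v₁).add (IsSelfAdjoint.add_star_self v₂)
  · obtain ⟨r, hr, hrw⟩ := h.exists_polynomial k t
    obtain ⟨c, r₁, r₂, rfl⟩ := key r hr
    have hφ : vectorState Ω (((t : ℂ) • (v₁ + star v₁ + (v₂ + star v₂))) ^ k) = c := by
      rw [vectorState_apply, hrw Ω h.star_fst_vacuum h.star_snd_vacuum]
      change inner ℂ Ω (c • Ω + v₁ (r₁ Ω) + v₂ (r₂ Ω)) = c
      rw [inner_add_right, inner_add_right, ← inner_star_apply v₁, ← inner_star_apply v₂,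
        h.star_fst_vacuum, h.star_snd_vacuum, inner_smul_right, inner_self_eq_norm_sq_to_K,
        h.norm_vacuum]
      simp
    rw [hφ, hrw (l w) (DFunLike.congr_fun h.star_fst_mul_creation w)
      (DFunLike.congr_fun h.star_snd_mul_creation w)]
    change star l (c • l w + v₁ (r₁ (l w)) + v₂ (r₂ (l w))) = c • w
    rw [map_add, map_add, map_smul, hl1, hl2, hll, add_zero, add_zero]
  · obtain ⟨r, hr, hrw⟩ := h.exists_polynomial k t
    obtain ⟨c, r₁, r₂, rfl⟩ := key r hr
    rw [hrw Ω h.star_fst_vacuum h.star_snd_vacuum]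
    change star l (c • Ω + v₁ (r₁ Ω) + v₂ (r₂ Ω)) = 0
    rw [map_add, map_add, map_smul, hl1, hl2, h.star_creation_vacuum, smul_zero, add_zero,
      add_zero]

/-- This is classical independence: the vector `(v₂ + v₂*) ^ j Ω` is still killed by `v₁*`, and on
such vectors `(v₁ + v₁*) ^ i` acts as its expectation modulo the range of `v₁`. -/
theorem vectorState_mul (i j : ℕ) :
    vectorState Ω ((v₁ + star v₁) ^ i * (v₂ + star v₂) ^ j) =
      semicircleMoment i * semicircleMoment j := by
  have h1 := isCreation_zero h.norm_vacuum h.star_fst_mul_fst h.star_fst_vacuum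
  have h2 := isCreation_zero h.norm_vacuum h.star_snd_mul_snd h.star_snd_vacuum
  have e1 := h1.vectorState_semicircular_pow 1 i
  have e2 := h2.vectorState_semicircular_pow 1 j
  rw [one_smul, one_pow, one_mul] at e1 e2
  have hc : Commute (star v₁) ((v₂ + star v₂) ^ j) := by
    refine (h.commute_star.add_right ?_).pow_right j
    exact h.commute.star_star
  have hw : star v₁ (((v₂ + star v₂) ^ j) Ω) = 0 := by
    rw [← mul_apply_eq_comp, hc.eq, mul_apply_eq_comp, h.star_fst_vacuum, map_zero]
  have hT : (v₁ + star v₁) ^ i ∈ Algebra.adjoin ℂ {(1 : ℂ) • (v₁ + star v₁)} := by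
    simp only [one_smul]
    exact pow_mem (Algebra.subset_adjoin (Set.mem_singleton _)) i
  obtain ⟨w', hw'⟩ := h1.apply_of_mem_adjoin_add 1 hT _ hw
  rw [vectorState_apply, mul_apply_eq_comp, hw', inner_add_right, h1.inner_vacuum_apply, add_zero,
    inner_smul_right, e1, ← vectorState_apply, e2]

theorem vectorState_pow (t : ℂ) (n : ℕ) :
    vectorState Ω ((t • (v₁ + star v₁ + (v₂ + star v₂))) ^ n) =
      t ^ n * twoSemicircleMoment n := by
  have hc : Commute (v₁ + star v₁) (v₂ + star v₂) :=
    (h.commute.add_left h.commute_star).add_right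
      (h.commute_star'.symm.add_left h.commute.star_star)
  rw [smul_pow, map_smul, smul_eq_mul, hc.add_pow, map_sum, twoSemicircleMoment]
  push_cast
  congr 1
  refine Finset.sum_congr rfl fun k _ => ?_
  rw [mul_smul_comm, mul_one, map_nsmul, nsmul_eq_mul, h.vectorState_mul]

end ShiftRelations

/-! ### Shifts of a Hilbert basis -/

section

variable {S : Type*} (b : HilbertBasis S ℂ H) {f g : S → S}

/-- The isometry that maps each basis vector `b s` to `b (f s)`. -/
noncomputable def basisShift (hf : f.Injective) : H →L[ℂ] H :=
  ((b.orthonormal.comp f hf).orthogonalFamily.linearIsometry.comp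
    b.repr.toLinearIsometry).toContinuousLinearMap

theorem basisShift_apply (hf : f.Injective) (s : S) : basisShift b hf (b s) = b (f s) := by
  classical
  change (b.orthonormal.comp f hf).orthogonalFamily.linearIsometry (b.repr (b s)) = _
  rw [b.repr_self, OrthogonalFamily.linearIsometry_apply_single]
  simp

omit [CompleteSpace H] in
variable {b} in
theorem HilbertBasis.clm_ext {T U : H →L[ℂ] H} (h : ∀ s, T (b s) = U (b s)) : T = U := by
  refine ContinuousLinearMap.ext_on (s := Set.range b) ?_ ?_
  · rw [dense_iff_closure_eq, ← Submodule.topologicalClosure_coe, b.dense_span]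
    rfl
  · rintro _ ⟨s, rfl⟩
    exact h s

omit [CompleteSpace H] in
variable {b} in
theorem HilbertBasis.eq_of_inner {x y : H} (h : ∀ s, inner ℂ (b s) x = inner ℂ (b s) y) :
    x = y := by
  refine b.repr.injective (lp.ext (funext fun s => ?_))
  rw [b.repr_apply_apply, b.repr_apply_apply, h]

theorem star_basisShift_apply (hf : f.Injective) (s : S) :
    star (basisShift b hf) (b (f s)) = b s := by
  classical
  refine HilbertBasis.eq_of_inner (b := b) fun t => ?_
  have := (orthonormal_iff_ite.1 b.orthonormal)
  rw [← inner_star_apply, star_star, basisShift_apply, this, this]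
  simp [hf.eq_iff]

theorem star_basisShift_apply_of_notMem (hf : f.Injective) {s : S} (hs : s ∉ Set.range f) :
    star (basisShift b hf) (b s) = 0 := by
  classical
  refine HilbertBasis.eq_of_inner (b := b) fun t => ?_
  have := (orthonormal_iff_ite.1 b.orthonormal)
  rw [← inner_star_apply, star_star, basisShift_apply, this, inner_zero_right,
    if_neg fun h => hs ⟨t, h⟩]

theorem star_basisShift_mul_self (hf : f.Injective) :
    star (basisShift b hf) * basisShift b hf = 1 :=
  HilbertBasis.clm_ext (b := b) fun s => by
    rw [mul_apply_eq_comp, basisShift_apply, star_basisShift_apply, one_apply_eq_self]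

theorem star_basisShift_mul_of_disjoint (hf : f.Injective) (hg : g.Injective)
    (h : ∀ s, g s ∉ Set.range f) : star (basisShift b hf) * basisShift b hg = 0 :=
  HilbertBasis.clm_ext (b := b) fun s => by
    rw [mul_apply_eq_comp, basisShift_apply, star_basisShift_apply_of_notMem b hf (h s)]
    rfl

theorem commute_basisShift (hf : f.Injective) (hg : g.Injective) (h : ∀ s, f (g s) = g (f s)) :
    Commute (basisShift b hf) (basisShift b hg) :=
  HilbertBasis.clm_ext (b := b) fun s => by
    simp only [mul_apply_eq_comp, basisShift_apply, h]

/-- The adjoint of the shift along `f` inverts `f` on its range and kills the other basis vectors;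
by `h` and `h'`, `g` preserves the range and its complement. -/
theorem commute_star_basisShift (hf : f.Injective) (hg : g.Injective)
    (h : ∀ s, f (g s) = g (f s)) (h' : ∀ s, g s ∈ Set.range f → s ∈ Set.range f) :
    Commute (star (basisShift b hf)) (basisShift b hg) :=
  HilbertBasis.clm_ext (b := b) fun s => by
    rw [mul_apply_eq_comp, mul_apply_eq_comp, basisShift_apply]
    by_cases hs : s ∈ Set.range f
    · obtain ⟨t, rfl⟩ := hs
      rw [← h, star_basisShift_apply, star_basisShift_apply, basisShift_apply]
    · rw [star_basisShift_apply_of_notMem b hf hs,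
        star_basisShift_apply_of_notMem b hf (fun h => hs (h' s h)), map_zero]

end

end

/-! ### A concrete model on a sequence space. -/

/-- The index set of the orthonormal basis of the Fock space: tensor products of basis vectors
indexed by pairs of natural numbers, with at least one factor. -/
abbrev FockIndex := (ℕ × ℕ) × List (ℕ × ℕ)

/-- The Fock space. -/
noncomputable abbrev FockSpace := lp (fun _ : FockIndex => ℂ) 2

theorem exists_shiftRelations :
    ∃ (Ω : FockSpace) (v₁ v₂ l : FockSpace →L[ℂ] FockSpace), ShiftRelations Ω v₁ v₂ l := by
  let b : HilbertBasis FockIndex ℂ FockSpace := HilbertBasis.ofRepr (LinearIsometryEquiv.refl ℂ _)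
  -- The shifts act on the first tensor factor, while the creation operator prepends the factor `(0,
  -- 0)`. Its range therefore avoids the vacuum, whose list is empty, and the ranges of both shifts.
  let f₁ : FockIndex → FockIndex := fun s => ((s.1.1 + 1, s.1.2), s.2)
  let f₂ : FockIndex → FockIndex := fun s => ((s.1.1, s.1.2 + 1), s.2)
  let g : FockIndex → FockIndex := fun s => ((0, 0), s.1 :: s.2)
  have h₁ : f₁.Injective := by
    rintro ⟨⟨i, j⟩, s⟩ ⟨⟨i', j'⟩, s'⟩ h
    simp only [f₁, Prod.mk.injEq, add_left_inj] at h ⊢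
    exact h
  have h₂ : f₂.Injective := by
    rintro ⟨⟨i, j⟩, s⟩ ⟨⟨i', j'⟩, s'⟩ h
    simp only [f₂, Prod.mk.injEq, add_left_inj] at h ⊢
    exact h
  have hg : g.Injective := by
    rintro ⟨x, s⟩ ⟨x', s'⟩ h
    simp only [g, Prod.mk.injEq, List.cons.injEq, true_and] at h ⊢
    exact h
  refine ⟨b ((0, 0), []), basisShift b h₁, basisShift b h₂, basisShift b hg, ?_⟩
  refine ⟨b.orthonormal.1 _, ?_, ?_, ?_, star_basisShift_mul_self b h₁,
    star_basisShift_mul_self b h₂, star_basisShift_mul_self b hg, ?_, ?_, ?_, ?_⟩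
  · exact star_basisShift_apply_of_notMem b h₁ (by simp [f₁])
  · exact star_basisShift_apply_of_notMem b h₂ (by simp [f₂])
  · exact star_basisShift_apply_of_notMem b hg (by simp [g])
  · exact star_basisShift_mul_of_disjoint b hg h₁ (by simp [f₁, g])
  · exact star_basisShift_mul_of_disjoint b hg h₂ (by simp [f₂, g])
  · exact commute_basisShift b h₁ h₂ fun _ => rfl
  · refine commute_star_basisShift b h₁ h₂ (fun _ => rfl) ?_
    rintro ⟨⟨i, j⟩, s⟩ ⟨⟨⟨i', j'⟩, s'⟩, h⟩
    simp only [f₁, f₂, Prod.mk.injEq] at h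
    exact ⟨((i', j), s), by simp [f₁, h.1.1]⟩

/-! ### Distributions of self-adjoint elements -/

section

variable {A : Type*} [CStarAlgebra A] {φ : A →ₗ[ℂ] ℂ} {a : A}

/-- Positivity suffices: `4a` is the difference of the squares of `a + 1` and `a - 1`, and `φ` is
real on both. -/
theorem IsState.im_eq_zero (hφ : IsState φ) (ha : IsSelfAdjoint a) : (φ a).im = 0 := by
  have h : ∀ x : A, (φ (star x * x)).im = 0 := fun x => ((Complex.nonneg_iff.1 (hφ.2 x)).2).symm
  have h1 := h (a + 1)
  have h2 := h (a - 1)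
  have e : star (a + 1) * (a + 1) = star (a - 1) * (a - 1) + (4 : ℂ) • a := by
    rw [star_add, star_sub, ha.star_eq, star_one, show (4 : ℂ) = ((4 : ℕ) : ℂ) by norm_num,
      Nat.cast_smul_eq_nsmul]
    noncomm_ring
  rw [e, map_add, map_smul, Complex.add_im, h2, zero_add] at h1
  simpa using h1

/-- The state composed with the continuous functional calculus is a positive functional on the
functions on the compact spectrum; its Riesz measure, pushed to `ℝ`, is the distribution. -/
theorem IsState.exists_hasDistribution (hφ : IsState φ) (ha : IsSelfAdjoint a) :
    ∃ ρ, HasDistribution φ a ρ := by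
  let f : CompactlySupportedContinuousMap (spectrum ℝ a) ℝ →ₗ[ℝ] ℝ :=
    { toFun := fun g => (φ (cfcHom ha (g : C(spectrum ℝ a, ℝ)))).re
      map_add' := fun g g' => by
        have : ((g + g' : CompactlySupportedContinuousMap (spectrum ℝ a) ℝ) :
          C(spectrum ℝ a, ℝ)) = g + g' := rfl
        rw [this, map_add, map_add, Complex.add_re]
      map_smul' := fun c g => by
        have : ((c • g : CompactlySupportedContinuousMap (spectrum ℝ a) ℝ) :
          C(spectrum ℝ a, ℝ)) = c • (g : C(spectrum ℝ a, ℝ)) := rfl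
        rw [this, map_smul, ← Complex.coe_smul, map_smul]
        simp }
  have hf : ∀ g, 0 ≤ g → 0 ≤ f g := by
    intro g hg
    -- A nonnegative function is `s* s` for its square root `s`, so positivity of `φ` applies.
    let s : C(spectrum ℝ a, ℝ) := ⟨fun x => √(g x), by fun_prop⟩
    have hs : (g : C(spectrum ℝ a, ℝ)) = star s * s := by
      ext x
      exact (Real.mul_self_sqrt (hg x)).symm
    change 0 ≤ (φ (cfcHom ha (g : C(spectrum ℝ a, ℝ)))).re
    rw [hs, map_mul, map_star]
    exact (Complex.nonneg_iff.1 (hφ.2 _)).1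
  let Λ := PositiveLinearMap.mk₀ f hf
  let μ := RealRMK.rieszMeasure Λ
  have hint : ∀ g : C(spectrum ℝ a, ℝ), ∫ x, g x ∂μ = (φ (cfcHom ha g)).re := fun g =>
    RealRMK.integral_rieszMeasure Λ ⟨g, HasCompactSupport.of_compactSpace _⟩
  have hpow : ∀ n : ℕ, ∫ x : spectrum ℝ a, (x : ℝ) ^ n ∂μ = (φ (a ^ n)).re := by
    intro n
    have h1 := hint ((ContinuousMap.restrict (spectrum ℝ a) (.id ℝ)) ^ n)
    rw [map_pow, cfcHom_id] at h1
    exact h1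
  have hμ : IsProbabilityMeasure μ := by
    have h1 := hpow 0
    simp only [pow_zero, hφ.1, Complex.one_re, integral_const, smul_eq_mul, mul_one] at h1
    rw [measureReal_def, ENNReal.toReal_eq_one_iff] at h1
    exact ⟨h1⟩
  refine ⟨μ.map Subtype.val, ha, Measure.isProbabilityMeasure_map (by fun_prop),
    ⟨spectrum ℝ a, ?_, ?_⟩, fun n => ?_⟩
  · exact isCompact_iff_compactSpace.2 inferInstance
  · have hm : MeasurableSet (spectrum ℝ a)ᶜ :=
      (isCompact_iff_compactSpace.2 inferInstance : IsCompact (spectrum ℝ a)).measurableSet.compl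
    rw [Measure.map_apply (by fun_prop) hm]
    simp
  · rw [integral_map (by fun_prop) (by fun_prop), hpow]
    exact Complex.ext (by simp) (by simpa using hφ.im_eq_zero (ha.pow n))

end

/-! ### Moments of compactly supported measures -/

/-- `μ` is a compactly supported probability measure. -/
def IsCompactProb (μ : Measure ℝ) : Prop :=
  IsProbabilityMeasure μ ∧ ∃ K : Set ℝ, IsCompact K ∧ μ Kᶜ = 0

theorem IsCompactProb.integrable {μ : Measure ℝ} (h : IsCompactProb μ) {f : ℝ → ℝ}
    (hf : Continuous f) : Integrable f μ := by
  obtain ⟨_, K, hK, hμK⟩ := h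
  have h1 : IntegrableOn f K μ := hf.continuousOn.integrableOn_compact hK
  rwa [IntegrableOn, Measure.restrict_eq_self_of_ae_mem (mem_ae_iff.2 hμK)] at h1

theorem IsCompactProb.dilation {μ : Measure ℝ} (h : IsCompactProb μ) (t : ℝ) :
    IsCompactProb (dilation t μ) := by
  obtain ⟨_, K, hK, hμK⟩ := h
  refine ⟨Measure.isProbabilityMeasure_map (by fun_prop), (fun x => t * x) '' K,
    hK.image (by fun_prop), ?_⟩
  rw [_root_.dilation, Measure.map_apply (by fun_prop)
    (hK.image (by fun_prop)).measurableSet.compl]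
  exact measure_mono_null (t := Kᶜ) (fun x hx hxK => hx (Set.mem_image_of_mem _ hxK)) hμK

theorem integral_pow_dilation (μ : Measure ℝ) (t : ℝ) (n : ℕ) :
    ∫ x, x ^ n ∂(dilation t μ) = t ^ n * ∫ x, x ^ n ∂μ := by
  rw [dilation, integral_map (by fun_prop) (by fun_prop), ← integral_const_mul]
  simp_rw [mul_pow]

theorem IsCompactProb.conv {μ ν : Measure ℝ} (hμ : IsCompactProb μ) (hν : IsCompactProb ν) :
    IsCompactProb (μ.conv ν) := by
  obtain ⟨_, K, hK, hμK⟩ := hμ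
  obtain ⟨_, L, hL, hνL⟩ := hν
  refine ⟨inferInstance, (fun p : ℝ × ℝ => p.1 + p.2) '' (K ×ˢ L),
    (hK.prod hL).image (by fun_prop), ?_⟩
  rw [Measure.conv, Measure.map_apply (by fun_prop)
    ((hK.prod hL).image (by fun_prop)).measurableSet.compl]
  refine measure_mono_null (t := Kᶜ ×ˢ Set.univ ∪ Set.univ ×ˢ Lᶜ) ?_ ?_
  · rintro ⟨x, y⟩ hxy
    by_contra hn
    simp only [Set.mem_union, Set.mem_prod, Set.mem_compl_iff, Set.mem_univ, and_true, true_and,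
      not_or, not_not] at hn
    exact hxy ⟨(x, y), hn, rfl⟩
  · refine measure_union_null ?_ ?_
    · rw [Measure.prod_prod, hμK, zero_mul]
    · rw [Measure.prod_prod, hνL, mul_zero]

theorem integral_pow_conv {μ ν : Measure ℝ} (hμ : IsCompactProb μ) (hν : IsCompactProb ν)
    (n : ℕ) : ∫ x, x ^ n ∂(μ.conv ν) =
      ∑ k ∈ Finset.range (n + 1), n.choose k * ((∫ x, x ^ k ∂μ) * ∫ x, x ^ (n - k) ∂ν) := by
  have hμν := hμ.conv hν
  have := hμ.1
  have := hν.1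
  rw [integral_conv (hμν.integrable (by fun_prop))]
  simp_rw [add_pow]
  have h1 : ∀ x : ℝ, ∫ y, ∑ k ∈ Finset.range (n + 1), x ^ k * y ^ (n - k) * (n.choose k : ℝ) ∂ν =
      ∑ k ∈ Finset.range (n + 1), x ^ k * ((n.choose k : ℝ) * ∫ y, y ^ (n - k) ∂ν) := by
    intro x
    rw [integral_finsetSum _ fun k _ => hν.integrable (by fun_prop)]
    refine Finset.sum_congr rfl fun k _ => ?_
    rw [← integral_const_mul, ← integral_const_mul]
    congr 1
    ext y
    ring
  simp_rw [h1]
  rw [integral_finsetSum _ fun k _ => hμ.integrable (by fun_prop)]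
  refine Finset.sum_congr rfl fun k _ => ?_
  rw [integral_mul_const]
  ring

/-! ### The semicircular distribution -/

theorem support_semicircle_density (n : ℕ) :
    (Function.support fun x : ℝ => √(4 - x ^ 2) / (2 * Real.pi) * x ^ n) ⊆ Set.Ioc (-2) 2 := by
  intro x hx
  by_contra hn
  refine hx ?_
  have : √(4 - x ^ 2) = 0 := by
    refine Real.sqrt_eq_zero_of_nonpos ?_
    rw [Set.mem_Ioc, not_and_or, not_lt, not_le] at hn
    rcases hn with h | h <;> nlinarith
  simp [this]

theorem integral_pow_semicircle_eq_intervalIntegral (n : ℕ) : ∫ x, x ^ n ∂semicircle =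
    (∫ x in (-2 : ℝ)..2, x ^ n * √(4 - x ^ 2)) / (2 * Real.pi) := by
  rw [semicircle, integral_withDensity_eq_integral_toReal_smul (by fun_prop)
    (Filter.Eventually.of_forall fun _ => ENNReal.ofReal_lt_top)]
  have h : ∀ x : ℝ, (ENNReal.ofReal (√(4 - x ^ 2) / (2 * Real.pi))).toReal • x ^ n =
      √(4 - x ^ 2) / (2 * Real.pi) * x ^ n := fun x => by
    rw [ENNReal.toReal_ofReal (by positivity), smul_eq_mul]
  simp_rw [h]
  rw [← intervalIntegral.integral_eq_integral_of_support_subset (support_semicircle_density n),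
    ← intervalIntegral.integral_div]
  congr 1
  ext x
  ring

theorem integral_sqrt_four_sub_sq : ∫ x in (-2 : ℝ)..2, √(4 - x ^ 2) = 2 * Real.pi := by
  have h := intervalIntegral.smul_integral_comp_mul_left (a := -1) (b := 1)
    (fun x : ℝ => √(4 - x ^ 2)) 2
  have h2 : ∀ x : ℝ, √(4 - (2 * x) ^ 2) = 2 * √(1 - x ^ 2) := fun x => by
    rw [show 4 - (2 * x) ^ 2 = 2 ^ 2 * (1 - x ^ 2) by ring,
      Real.sqrt_mul (by norm_num), Real.sqrt_sq (by norm_num)]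
  simp_rw [h2] at h
  rw [intervalIntegral.integral_const_mul, integral_sqrt_one_sub_sq] at h
  norm_num at h
  rw [← h]
  ring

/-- The function `x ^ (n + 1) (4 - x²)^(3/2)` vanishes at `±2`, so its derivative has integral zero.
Differentiability is needed only inside the interval. -/
theorem integral_pow_mul_sqrt_recursion (n : ℕ) :
    (n + 4 : ℝ) * ∫ x in (-2 : ℝ)..2, x ^ (n + 2) * √(4 - x ^ 2) =
      4 * (n + 1) * ∫ x in (-2 : ℝ)..2, x ^ n * √(4 - x ^ 2) := by
  have hder : ∀ x ∈ Set.Ioo (-2 : ℝ) 2,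
      HasDerivAt (fun x : ℝ => x ^ (n + 1) * ((4 - x ^ 2) * √(4 - x ^ 2)))
        (4 * (n + 1) * (x ^ n * √(4 - x ^ 2)) - (n + 4) * (x ^ (n + 2) * √(4 - x ^ 2))) x := by
    intro x hx
    have hpos : 0 < 4 - x ^ 2 := by nlinarith [hx.1, hx.2]
    have h1 : HasDerivAt (fun x : ℝ => 4 - x ^ 2) (-(2 * x)) x := by
      simpa using (hasDerivAt_pow 2 x).const_sub 4
    have h2 := h1.sqrt hpos.ne'
    refine HasDerivAt.congr_deriv ((hasDerivAt_pow (n + 1) x).mul (h1.mul h2)) ?_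
    have hs := Real.mul_self_sqrt hpos.le
    have hs0 : √(4 - x ^ 2) ≠ 0 := (Real.sqrt_pos.2 hpos).ne'
    have h3 : (4 - x ^ 2) * (-(2 * x) / (2 * √(4 - x ^ 2))) = -x * √(4 - x ^ 2) := by
      rw [mul_div_assoc', div_eq_iff (mul_ne_zero two_ne_zero hs0)]
      linear_combination 2 * x * hs
    rw [h3]
    push_cast
    ring
  have hi := intervalIntegral.integral_eq_sub_of_hasDerivAt_of_le (by norm_num)
    (by fun_prop) hder ((by fun_prop : Continuous _).intervalIntegrable _ _)
  rw [intervalIntegral.integral_sub ((by fun_prop : Continuous _).intervalIntegrable _ _)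
    ((by fun_prop : Continuous _).intervalIntegrable _ _), intervalIntegral.integral_const_mul,
    intervalIntegral.integral_const_mul] at hi
  norm_num at hi
  linarith

theorem semicircleMoment_recursion (n : ℕ) :
    (n + 4) * semicircleMoment (n + 2) = 4 * (n + 1) * semicircleMoment n := by
  rcases Nat.even_or_odd' n with ⟨k, rfl | rfl⟩
  · have e1 : semicircleMoment (2 * k + 2) = catalan (k + 1) := by
      rw [semicircleMoment, if_pos (by simp [parity_simps])]
      congr 1
      omega
    have e2 : semicircleMoment (2 * k) = catalan k := by simp [semicircleMoment]
    have h1 := succ_mul_catalan_eq_centralBinom k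
    have h2 := succ_mul_catalan_eq_centralBinom (k + 1)
    have h3 := Nat.succ_mul_centralBinom_succ k
    rw [e1, e2]
    rw [← h1, ← h2] at h3
    have : (k + 1) * ((k + 2) * catalan (k + 1)) = (k + 1) * (2 * (2 * k + 1) * catalan k) := by
      linarith
    have := Nat.eq_of_mul_eq_mul_left (Nat.succ_pos k) this
    linarith
  · rw [semicircleMoment, semicircleMoment, if_neg (by simp [parity_simps]),
      if_neg (by simp [parity_simps])]
    simp

theorem integral_pow_semicircle (n : ℕ) : ∫ x, x ^ n ∂semicircle = semicircleMoment n := by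
  rw [integral_pow_semicircle_eq_intervalIntegral, div_eq_iff Real.two_pi_pos.ne']
  induction n using Nat.strong_induction_on with
  | _ n ih =>
    match n with
    | 0 => simp [semicircleMoment, integral_sqrt_four_sub_sq]
    | 1 =>
      have h := intervalIntegral.integral_comp_neg (a := -2) (b := 2)
        (fun x : ℝ => x ^ 1 * √(4 - x ^ 2))
      have h0 : semicircleMoment 1 = 0 := by simp [semicircleMoment]
      rw [h0, Nat.cast_zero, zero_mul]
      simp only [pow_one, neg_sq, neg_mul, neg_neg, intervalIntegral.integral_neg] at h ⊢
      linarith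
    | n + 2 =>
      have h1 := integral_pow_mul_sqrt_recursion n
      have h2 := semicircleMoment_recursion n
      have h3 : ((n : ℝ) + 4) * semicircleMoment (n + 2) = 4 * (n + 1) * semicircleMoment n := by
        exact_mod_cast h2
      rw [ih n (by omega)] at h1
      have h4 : (n + 4 : ℝ) ≠ 0 := by positivity
      apply mul_left_cancel₀ h4
      rw [h1]
      linear_combination (-(2 * Real.pi)) * h3

theorem isCompactProb_semicircle : IsCompactProb semicircle := by
  have hd : Measurable fun x : ℝ => ENNReal.ofReal (√(4 - x ^ 2) / (2 * Real.pi)) := by fun_prop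
  have hsupp : (Function.support fun x : ℝ => √(4 - x ^ 2) / (2 * Real.pi)) ⊆ Set.Icc (-2) 2 := by
    have := support_semicircle_density 0
    simp only [pow_zero, mul_one] at this
    exact this.trans Set.Ioc_subset_Icc_self
  constructor
  · have hint : Integrable fun x : ℝ => √(4 - x ^ 2) / (2 * Real.pi) :=
      Continuous.integrable_of_hasCompactSupport (by fun_prop)
        (HasCompactSupport.of_support_subset_isCompact isCompact_Icc hsupp)
    constructor
    rw [semicircle, withDensity_apply _ MeasurableSet.univ, Measure.restrict_univ,
      ← ofReal_integral_eq_lintegral_ofReal hint (Filter.Eventually.of_forall fun x => by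
        positivity)]
    have h := support_semicircle_density 0
    simp only [pow_zero, mul_one] at h
    rw [← intervalIntegral.integral_eq_integral_of_support_subset h,
      intervalIntegral.integral_div, integral_sqrt_four_sub_sq, div_self Real.two_pi_pos.ne',
      ENNReal.ofReal_one]
  · refine ⟨Set.Icc (-2) 2, isCompact_Icc, ?_⟩
    rw [semicircle, withDensity_apply _ measurableSet_Icc.compl,
      setLIntegral_congr_fun measurableSet_Icc.compl (g := fun _ => 0) fun x hx => ?_,
      lintegral_zero]
    have : x ∉ Function.support fun x : ℝ => √(4 - x ^ 2) / (2 * Real.pi) := fun h => hx (hsupp h)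
    rw [Function.notMem_support] at this
    simp only [this, ENNReal.ofReal_zero]

theorem isCompactProb_muOne : IsCompactProb muOne :=
  (isCompactProb_semicircle.dilation _).conv (isCompactProb_semicircle.dilation _)

theorem integral_pow_muOne (n : ℕ) :
    ∫ x, x ^ n ∂muOne = (1 / √2) ^ n * twoSemicircleMoment n := by
  rw [muOne, integral_pow_conv (isCompactProb_semicircle.dilation _)
    (isCompactProb_semicircle.dilation _), twoSemicircleMoment]
  push_cast
  rw [Finset.mul_sum]
  refine Finset.sum_congr rfl fun k hk => ?_
  have hk' : k + (n - k) = n := by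
    rw [Finset.mem_range] at hk
    omega
  rw [integral_pow_dilation, integral_pow_dilation, integral_pow_semicircle,
    integral_pow_semicircle]
  conv_rhs => rw [← hk', pow_add]
  rw [hk']
  ring

/-! ### The recursion for the moments of `muQ` -/

section

open PowerSeries

theorem HasDistribution.of_integral_pow {A : Type*} [CStarAlgebra A] {φ : A →ₗ[ℂ] ℂ} {a : A}
    {μ : Measure ℝ} (ha : IsSelfAdjoint a) (hμ : IsCompactProb μ)
    (h : ∀ n : ℕ, φ (a ^ n) = ((∫ x, x ^ n ∂μ : ℝ) : ℂ)) : HasDistribution φ a μ :=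
  ⟨ha, hμ.1, hμ.2, h⟩

theorem isFreeAddConv_freeAddConv {μ ν : Measure ℝ} (h : ∃ ρ, IsFreeAddConv μ ν ρ) :
    IsFreeAddConv μ ν (freeAddConv μ ν) := by
  rw [freeAddConv, dif_pos h]
  exact h.choose_spec

/-- The array is `F n k = φ(a ^ k (a + b) ^ n)` in the Fock model. The second index is needed to
close the recursion; `k = 0` gives the moments of `muQ q`. -/
theorem exists_moments_muQ {q : ℝ} (hq1 : q ≤ 1) :
    IsCompactProb (muQ q) ∧ ∃ F : ℕ → ℕ → ℂ,
      (∀ n, ((∫ x, x ^ n ∂(muQ q) : ℝ) : ℂ) = F n 0) ∧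
      (∀ k, F 0 k = ((√q * (1 / √2) : ℝ) : ℂ) ^ k * twoSemicircleMoment k) ∧
      (∀ k, F 1 k = F 0 (k + 1)) ∧
      ∀ n k, F (n + 2) k = F (n + 1) (k + 1) +
        (1 - q : ℂ) * ∑ p ∈ Finset.HasAntidiagonal.antidiagonal n, F p.1 0 * F p.2 k := by
  obtain ⟨Ω, v₁, v₂, l, hs⟩ := exists_shiftRelations
  have hc := hs.isCreation (√q * (1 / √2))
  set a : FockSpace →L[ℂ] FockSpace :=
    ((√q * (1 / √2) : ℝ) : ℂ) • (v₁ + star v₁ + (v₂ + star v₂)) with ha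
  set b : FockSpace →L[ℂ] FockSpace := ((√(1 - q) : ℝ) : ℂ) • (l + star l) with hb
  have hφ : IsState (vectorState Ω) := isState_vectorState hs.norm_vacuum
  have hbs : IsSelfAdjoint b := by
    rw [IsSelfAdjoint, hb, star_smul, star_add, star_star, add_comm]
    simp
  have hfree := hc.freelyIndependent ((√(1 - q) : ℝ) : ℂ)
  have hda : HasDistribution (vectorState Ω) a (dilation √q muOne) := by
    refine .of_integral_pow hc.isSelfAdjoint (isCompactProb_muOne.dilation _) fun n => ?_
    rw [ha, hs.vectorState_pow, integral_pow_dilation, integral_pow_muOne]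
    push_cast
    ring
  have hdb : HasDistribution (vectorState Ω) b (dilation √(1 - q) semicircle) := by
    refine .of_integral_pow hbs (isCompactProb_semicircle.dilation _) fun n => ?_
    rw [hb, hc.vectorState_semicircular_pow, integral_pow_dilation, integral_pow_semicircle]
    push_cast
    ring
  have hex : ∃ ρ, IsFreeAddConv (dilation √q muOne) (dilation √(1 - q) semicircle) ρ := by
    obtain ⟨ρ, hρ⟩ := hφ.exists_hasDistribution (hc.isSelfAdjoint.add hbs)
    exact ⟨ρ, _, _, vectorState Ω, a, b, hφ, hfree, hda, hdb, hρ⟩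
  -- The chosen convolution may come from another algebra `A`; equality of moments transfers it to
  -- the model.
  obtain ⟨A, _, φ, x, y, hφ', hfree', hx, hy, hxy⟩ := isFreeAddConv_freeAddConv hex
  refine ⟨⟨hxy.2.1, hxy.2.2.1⟩, fun n k => vectorState Ω (a ^ k * (a + b) ^ n), fun n => ?_,
    fun k => ?_, hc.vectorState_pow_one _, fun n k => ?_⟩
  · simp only [pow_zero, one_mul]
    refine (hxy.2.2.2 n).symm.trans ?_
    exact hfree'.moments_add_eq hφ'.1 hφ.1 hfree
      (fun m => (hx.2.2.2 m).trans (hda.2.2.2 m).symm)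
      (fun m => (hy.2.2.2 m).trans (hdb.2.2.2 m).symm) n
  · simp only [pow_zero, mul_one]
    exact hs.vectorState_pow _ k
  · have h := hc.vectorState_pow_recursion ((√(1 - q) : ℝ) : ℂ) n k
    have hv : ((√(1 - q) : ℝ) : ℂ) ^ 2 = 1 - q := by
      rw [← Complex.ofReal_pow, Real.sq_sqrt (by linarith)]
      push_cast
      rfl
    rw [hv] at h
    exact h

/-- These moments count two-coloured diagrams; rescaling the variable by `t` multiplies the `s`-th
cumulant by `t ^ s`. -/
theorem hasFreeCumulants_twoSemicircleMoment {K : Type*} [Field K] (t : K) :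
    HasFreeCumulants (mk fun k => t ^ k * (twoSemicircleMoment k : K))
      fun s => t ^ s * (linkedCount Finset.univ s : K) := by
  have hA : (mk fun k => t ^ k * (twoSemicircleMoment k : K)) =
      rescale t (map (Nat.castRingHom K) (diagramSeries Finset.univ)) := by
    ext k
    rw [coeff_rescale, coeff_map, diagramSeries, coeff_mk, coeff_mk, diagramCount_univ_eq]
    rfl
  constructor
  · rw [hA, coeff_rescale, coeff_map, diagramSeries, coeff_mk, diagramCount_zero]
    simp
  · intro n hn
    rw [coeff_mk, ← diagramCount_univ_eq, diagramCount_eq_sum _ hn]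
    push_cast
    rw [Finset.mul_sum]
    refine Finset.sum_congr rfl fun s hs => ?_
    have hsn := (Finset.mem_Icc.1 hs).2
    rw [coeff_X_mul_pow_of_le _ hsn, coeff_X_mul_pow_of_le _ hsn, hA, ← map_pow, ← map_pow,
      coeff_rescale, coeff_map, ← Nat.add_sub_of_le hsn, pow_add, Nat.add_sub_cancel_left]
    simp only [eq_natCast]
    ring

theorem linkedCount_univ_of_odd {s : ℕ} (hs : Odd s) : linkedCount Finset.univ s = 0 := by
  rw [linkedCount_univ hs.pos, biconPairPartitions_of_odd hs]
  simp

/-- Read off from the moment-cumulant relation at `n = 2`, where the second moment is `2` and the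
first cumulant vanishes. -/
theorem linkedCount_univ_two : linkedCount Finset.univ 2 = 2 := by
  have h := diagramCount_eq_sum Finset.univ (n := 2) two_pos
  have h2 : twoSemicircleMoment 2 = 2 := by
    simp [twoSemicircleMoment, semicircleMoment, Finset.sum_range_succ]
  rw [diagramCount_univ_eq, h2, show Finset.Icc 1 2 = {1, 2} from rfl,
    Finset.sum_pair (by norm_num), linkedCount_univ_of_odd odd_one, zero_mul, zero_add,
    coeff_X_mul_pow_of_le _ le_rfl, Nat.sub_self, coeff_zero_eq_constantCoeff_apply, map_pow,
    ← coeff_zero_eq_constantCoeff_apply, diagramSeries, coeff_mk, diagramCount_zero, one_pow,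
    mul_one] at h
  exact h.symm

/-- The moments of `muQ q` through its free cumulants. -/
theorem integral_pow_muQ_eq_sum {q : ℝ} (hq1 : q ≤ 1) {n : ℕ} (hn : 0 < n) :
    ∫ x, x ^ n ∂(muQ q) =
      (1 - q) * coeff n ((X * mk fun k => ∫ x, x ^ k ∂(muQ q)) ^ 2) +
        ∑ s ∈ Finset.Icc 1 n, (√q * (1 / √2)) ^ s * linkedCount Finset.univ s *
          coeff n ((X * mk fun k => ∫ x, x ^ k ∂(muQ q)) ^ s) := by
  obtain ⟨-, F, hF, h0, h1, h2⟩ := exists_moments_muQ hq1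
  have h := coeff_eq_of_semicircular_perturbation
    (hasFreeCumulants_twoSemicircleMoment ((√q * (1 / √2) : ℝ) : ℂ)) _ F
    (fun k => by rw [h0, coeff_mk]) h1 h2 hn
  have hM : (mk fun n => F n 0) =
      map Complex.ofRealHom (mk fun k => ∫ x, x ^ k ∂(muQ q)) := by
    ext k
    rw [coeff_map, coeff_mk, coeff_mk, ← hF]
    rfl
  have hX : (X : PowerSeries ℂ) = map Complex.ofRealHom X := (map_X _).symm
  rw [← hF, hM, ← mul_pow, hX, ← map_mul, ← map_pow, coeff_map] at h
  simp only [← map_pow, coeff_map, Complex.ofRealHom_eq_coe] at h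
  exact_mod_cast h

/-- Among summands with odd total `n - s` one is odd, and `s > 0` makes it smaller than `n`. So the
vanishing of odd moments propagates by strong induction. -/
theorem coeff_X_mul_mk_pow_eq_zero {R : Type*} [CommSemiring R] {M : ℕ → R} {n s : ℕ}
    (hM : ∀ m < n, Odd m → M m = 0) (hn : Odd n) (hs : Even s) (hs0 : 0 < s) :
    coeff n ((X * mk M) ^ s) = 0 := by
  rcases lt_or_ge n s with h | h
  · exact coeff_X_mul_pow_of_lt _ h
  rw [coeff_X_mul_pow_of_le _ h, coeff_pow_eq_sum_antidiagonalTuple]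
  refine Finset.sum_eq_zero fun x hx => ?_
  rw [Finset.Nat.mem_antidiagonalTuple] at hx
  have : ∃ i, Odd (x i) := by
    by_contra! hx'
    have : Even (∑ i, x i) := Finset.even_sum _ fun i _ => Nat.not_odd_iff_even.1 (hx' i)
    rw [hx, Nat.even_sub h] at this
    exact Nat.not_even_iff_odd.2 hn (this.2 hs)
  obtain ⟨i, hi⟩ := this
  have hle : x i ≤ ∑ i, x i := Finset.single_le_sum (fun _ _ => Nat.zero_le _) (Finset.mem_univ i)
  refine Finset.prod_eq_zero (Finset.mem_univ i) ?_
  rw [coeff_mk]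
  exact hM _ (by omega) hi

theorem sq_sqrt_mul_one_div_sqrt_two {q : ℝ} (hq0 : 0 ≤ q) : (√q * (1 / √2)) ^ 2 = q / 2 := by
  rw [mul_pow, div_pow, one_pow, Real.sq_sqrt hq0, Real.sq_sqrt zero_le_two]
  ring

theorem integral_pow_muQ_of_odd {q : ℝ} (hq1 : q ≤ 1) {n : ℕ} (hn : Odd n) :
    ∫ x, x ^ n ∂(muQ q) = 0 := by
  induction n using Nat.strong_induction_on with
  | _ n ih =>
    rw [integral_pow_muQ_eq_sum hq1 hn.pos, coeff_X_mul_mk_pow_eq_zero ih hn even_two two_pos,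
      mul_zero, zero_add]
    refine Finset.sum_eq_zero fun s hs => ?_
    rcases Nat.even_or_odd s with h | h
    · rw [coeff_X_mul_mk_pow_eq_zero ih hn h (Finset.mem_Icc.1 hs).1, mul_zero]
    · rw [linkedCount_univ_of_odd h]
      simp

theorem integral_pow_muQ_of_even {q : ℝ} (hq0 : 0 ≤ q) (hq1 : q ≤ 1) {m : ℕ} (hm : 0 < m) :
    ∫ x, x ^ (2 * m) ∂(muQ q) =
      coeff (2 * m) ((X * mk fun k => ∫ x, x ^ k ∂(muQ q)) ^ 2) +
        ∑ j ∈ Finset.Icc 2 m, 2 * (q / 2) ^ j * ((biconPairPartitions (2 * j)).ncard : ℝ) *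
          coeff (2 * m) ((X * mk fun k => ∫ x, x ^ k ∂(muQ q)) ^ (2 * j)) := by
  rw [integral_pow_muQ_eq_sum hq1 (by omega)]
  set T := fun s => coeff (2 * m) ((X * mk fun k => ∫ x, x ^ k ∂(muQ q)) ^ s) with hT
  have h1 : ∑ s ∈ Finset.Icc 1 (2 * m), (√q * (1 / √2)) ^ s * linkedCount Finset.univ s * T s =
      ∑ j ∈ Finset.Icc 1 m, (q / 2) ^ j * linkedCount Finset.univ (2 * j) * T (2 * j) := by
    rw [← Finset.sum_subset (s₁ := (Finset.Icc 1 m).image (2 * ·)) (s₂ := Finset.Icc 1 (2 * m))]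
    · rw [Finset.sum_image fun i _ j _ h => by simpa using h]
      refine Finset.sum_congr rfl fun j _ => ?_
      rw [pow_mul, sq_sqrt_mul_one_div_sqrt_two hq0]
    · intro s hs
      simp only [Finset.mem_image, Finset.mem_Icc] at hs ⊢
      omega
    · intro s hs hs'
      rw [linkedCount_univ_of_odd, Nat.cast_zero, mul_zero, zero_mul]
      by_contra h
      obtain ⟨j, rfl⟩ := (Nat.not_odd_iff_even.1 h).two_dvd
      refine hs' (Finset.mem_image_of_mem _ ?_)
      rw [Finset.mem_Icc] at hs ⊢
      omega
  have h2 : Finset.Icc 1 m = insert 1 (Finset.Icc 2 m) := by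
    ext j
    simp only [Finset.mem_insert, Finset.mem_Icc]
    omega
  change (1 - q) * T 2 + ∑ s ∈ Finset.Icc 1 (2 * m), _ * T s =
    T 2 + ∑ j ∈ Finset.Icc 2 m, _ * T (2 * j)
  -- The term `j = 1` joins the semicircular part: `(1 - q) + (q / 2) * 2 = 1` is the second free
  -- cumulant.
  rw [h1, h2, Finset.sum_insert (by simp), mul_one, linkedCount_univ_two, ← add_assoc]
  congr 1
  · push_cast
    ring
  · refine Finset.sum_congr rfl fun j hj => ?_
    rw [linkedCount_univ (by have := (Finset.mem_Icc.1 hj).1; omega)]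
    push_cast
    ring

end

theorem corollary5p3 (q : ℝ) (hq0 : 0 ≤ q) (hq1 : q < 1)
    (M : ℕ → ℝ) (hM : ∀ n, M n = ∫ x, x ^ n ∂(muQ q)) :
    (∀ n : ℕ, Integrable (fun x : ℝ => x ^ n) (muQ q)) ∧
    (∀ n : ℕ, Odd n → M n = 0) ∧
    M 2 = 1 ∧
    (∀ n : ℕ, Even n → 4 ≤ n →
      M n = (∑ k ∈ Finset.HasAntidiagonal.antidiagonal (n - 2), M k.1 * M k.2) +
        ∑ j ∈ Finset.Icc 2 (n / 2), ∑ k ∈ Finset.Nat.antidiagonalTuple (2 * j) (n - 2 * j),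
          2 * (q / 2) ^ j * ((biconPairPartitions (2 * j)).ncard : ℝ) * ∏ i, M (k i)) := by
  obtain ⟨hcomp, -⟩ := exists_moments_muQ hq1.le
  have hsq : ∀ n, 2 ≤ n →
      PowerSeries.coeff n ((PowerSeries.X * PowerSeries.mk fun k => ∫ x, x ^ k ∂(muQ q)) ^ 2) =
        ∑ k ∈ Finset.HasAntidiagonal.antidiagonal (n - 2), M k.1 * M k.2 := by
    intro n hn
    rw [coeff_X_mul_pow_of_le _ hn, sq, PowerSeries.coeff_mul]
    simp only [PowerSeries.coeff_mk, hM]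
  refine ⟨fun n => hcomp.integrable (by fun_prop), fun n hn => ?_, ?_, fun n hn h4 => ?_⟩
  · rw [hM, integral_pow_muQ_of_odd hq1.le hn]
  · have h := integral_pow_muQ_of_even hq0 hq1.le (m := 1) one_pos
    have := hcomp.1
    rw [mul_one, hsq 2 le_rfl, ← hM] at h
    rw [h]
    -- For `n = 2` there are no terms with `j ≥ 2`; what remains is the square of the total mass
    -- `1`.
    simp [hM]
  · obtain ⟨m, rfl⟩ := hn.two_dvd
    have h := integral_pow_muQ_of_even hq0 hq1.le (m := m) (by omega)
    rw [hsq _ (by omega), ← hM] at h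
    rw [h, Nat.mul_div_cancel_left m two_pos]
    congr 1
    refine Finset.sum_congr rfl fun j hj => ?_
    rw [coeff_X_mul_pow_of_le _ (by have := (Finset.mem_Icc.1 hj).2; omega),
      coeff_pow_eq_sum_antidiagonalTuple, Finset.mul_sum]
    simp only [PowerSeries.coeff_mk, hM]
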